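/- **Setting.** Let $\mathcal H=\ell^2(\mathbf Z;\mathbf C^2)$. For a family $C(x)=\begin{pmatrix}a(x)&b(x)\\c(x)&d(x)\end{pmatrix}\in U(2)$, $x\in\mathbf Z$, let $U=SC$ be the operator on $\mathcal H$ with $(C\psi)(x)=C(x)\psi(x)$ and $(S\psi)(x)=(\psi^{(0)}(x+1),\psi^{(1)}(x-1))$. Let $\sigma(U)$ be its spectrum, let $\sigma_d(U)$ be the set of isolated points of $\sigma(U)$ that are eigenvalues of $U$ of finite multiplicity, and put $\sigma_{ess}(U)=\sigma(U)\setminus\sigma_d(U)$. Let $\alpha,\beta,\gamma,\beta',\gamma'\in[0,2\pi)$, $p\in(0,1]$, $q\in[0,1]$ with $p^2+q^2=1$, and put $$C_0=e^{i\gamma/2}\begin{pmatrix}pe^{i(\alpha-\gamma/2)}&qe^{i(\beta-\gamma/2)}\\-qe^{-i(\beta-\gamma/2)}&pe^{-i(\alpha-\gamma/2)}\end{pmatrix},\qquad C_1=e^{i\gamma'/2}\begin{pmatrix}0&e^{i(\beta'-\gamma'/2)}\\-e^{-i(\beta'-\gamma'/2)}&0\end{pmatrix}.$$ Put $J_\gamma=[\arccos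 p+\tfrac\gamma2,\ \pi-\arccos p+\tfrac\gamma2]\cup[\pi+\arccos p+\tfrac\gamma2,\ 2\pi-\arccos p+\tfrac\gamma2]$, let $J_{\gamma,\mathcal T}$ be the set of the four end points of these intervals, and let $\mathcal T=\{e^{i\theta}\in\sigma_{ess}(U):\theta\in J_{\gamma,\mathcal T}\}$. For $y\in\mathbf Z$ write $\mathbf e_y=\{y-1,y\}$. We call $\mathbf e_y$ an edge defect of $C$ if $C(y-1)=C(y)$ and this matrix has the form of $C_1$ for some values of $\beta',\gamma'$ in $[0,2\pi)$. Let $Y\subset\mathbf Z$ be a finite, possibly empty, set and $\mathbf e=\bigcup_{y\in Y}\mathbf e_y$. Let $C_2(x)\in U(2)$, $x\in\mathbf Z$, be such that, for some constants $\rho,M,\delta>0$ and all $x\in\mathbf Z$, every entry of $C_2(x)-C_0$ has modulus at most $Me^{-\rho\sqrt{1+x^2}}$, and the upper left entry $a_2(x)$ of $C_2(x)$ satisfies $|a_2(x)|\ge\delta$. Let $C(x)=C_1$ for $x\in\mathbf e$ and $C(x)=C_2(x)$ for $x\notin\mathbf e$. **Corollary 1.4.** Assume that $(\gamma'+\pi)/2\in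 J_\gamma\setminus J_{\gamma,\mathcal T}$ modulo $2\pi$, that is, $(\gamma'+\pi)/2+2\pi k\in J_\gamma\setminus J_{\gamma,\mathcal T}$ for some $k\in\mathbf Z$. Then $C$ has no edge defect if and only if $\mathbf e=\emptyset$, and $\mathbf e=\emptyset$ if and only if $U$ has no eigenvalue in $\sigma_{ess}(U)\setminus\mathcal T$. -/

import Mathlib

noncomputable section

/-- The state space `ℓ²(ℤ; ℂ²)`, with the Euclidean norm on `ℂ²`. -/
abbrev WalkSpace : Type := lp (fun _ : ℤ => EuclideanSpace ℂ (Fin 2)) 2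

/-- The group `U(2)`. -/
abbrev U2 : Type := Matrix.unitaryGroup (Fin 2) ℂ

lemma walk_summable (ψ : WalkSpace) : Summable fun x => ‖ψ x‖ ^ 2 := by
  have h := (memℓp_gen_iff (p := 2) (by norm_num)).1 (lp.memℓp ψ)
  simpa using h

lemma walk_norm_sq (ψ : WalkSpace) : ‖ψ‖ ^ 2 = ∑' x, ‖ψ x‖ ^ 2 := by
  have h := lp.norm_rpow_eq_tsum (p := 2) (by norm_num) ψ
  simpa using h

lemma walk_memℓp (f : ℤ → EuclideanSpace ℂ (Fin 2)) (hf : Summable fun x => ‖f x‖ ^ 2) :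
    Memℓp f 2 := by
  refine (memℓp_gen_iff (p := 2) (by norm_num)).2 ?_
  simpa using hf

lemma norm_toEuclideanCLM_unitary (A : U2) (v : EuclideanSpace ℂ (Fin 2)) :
    ‖Matrix.toEuclideanCLM (n := Fin 2) (𝕜 := ℂ) (A : Matrix (Fin 2) (Fin 2) ℂ) v‖ = ‖v‖ := by
  have hu : Matrix.toEuclideanCLM (n := Fin 2) (𝕜 := ℂ) (A : Matrix (Fin 2) (Fin 2) ℂ) ∈
      unitary (EuclideanSpace ℂ (Fin 2) →L[ℂ] EuclideanSpace ℂ (Fin 2)) :=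
    Unitary.map_mem _ A.2
  exact ContinuousLinearMap.norm_map_of_mem_unitary hu v

/-- The coin operator `(C ψ)(x) = C(x) ψ(x)` of a family of unitary matrices. -/
def coinOp (C : ℤ → U2) : WalkSpace →ₗᵢ[ℂ] WalkSpace where
  toFun ψ := ⟨fun x => Matrix.toEuclideanCLM (n := Fin 2) (𝕜 := ℂ) (C x).1 (ψ x),
    walk_memℓp _ (by simpa only [norm_toEuclideanCLM_unitary] using walk_summable ψ)⟩
  map_add' ψ φ := by
    ext1; funext x; exact map_add _ (ψ x) (φ x)
  map_smul' c ψ := by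
    ext1; funext x; exact map_smul _ c (ψ x)
  norm_map' ψ := by
    refine (sq_eq_sq₀ (norm_nonneg _) (norm_nonneg _)).1 ?_
    rw [walk_norm_sq, walk_norm_sq]
    exact tsum_congr fun x => congrArg (· ^ 2) (norm_toEuclideanCLM_unitary (C x) (ψ x))

lemma walk_summable_coord (ψ : WalkSpace) (i : Fin 2) : Summable fun x => ‖ψ x i‖ ^ 2 := by
  refine Summable.of_nonneg_of_le (fun x => by positivity) (fun x => ?_) (walk_summable ψ)
  gcongr
  exact PiLp.norm_apply_le (ψ x) i

lemma walk_norm_sq_coord (ψ : WalkSpace) :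
    ‖ψ‖ ^ 2 = ∑' x, ‖ψ x 0‖ ^ 2 + ∑' x, ‖ψ x 1‖ ^ 2 := by
  rw [walk_norm_sq, ← (walk_summable_coord ψ 0).tsum_add (walk_summable_coord ψ 1)]
  exact tsum_congr fun x => by simp [EuclideanSpace.norm_sq_eq]

lemma shift_memℓp (ψ : WalkSpace) :
    Memℓp (fun x : ℤ => (!₂[ψ (x + 1) 0, ψ (x - 1) 1] : EuclideanSpace ℂ (Fin 2))) 2 := by
  refine walk_memℓp _ ?_
  have h0 := (Equiv.addRight (1 : ℤ)).summable_iff.2 (walk_summable_coord ψ 0)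
  have h1 := (Equiv.subRight (1 : ℤ)).summable_iff.2 (walk_summable_coord ψ 1)
  refine (h0.add h1).congr fun x => ?_
  simp [EuclideanSpace.norm_sq_eq]

/-- The shift operator `(S ψ)(x) = (ψ⁽⁰⁾(x + 1), ψ⁽¹⁾(x - 1))`. -/
def shiftOp : WalkSpace →ₗᵢ[ℂ] WalkSpace where
  toFun ψ := ⟨fun x => !₂[ψ (x + 1) 0, ψ (x - 1) 1], shift_memℓp ψ⟩
  map_add' ψ φ := by
    ext x i; fin_cases i <;> rfl
  map_smul' c ψ := by
    ext x i; fin_cases i <;> rfl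
  norm_map' ψ := by
    refine (sq_eq_sq₀ (norm_nonneg _) (norm_nonneg _)).1 ?_
    rw [walk_norm_sq_coord, walk_norm_sq_coord]
    exact congrArg₂ (· + ·) ((Equiv.addRight (1 : ℤ)).tsum_eq fun x => ‖ψ x 0‖ ^ 2)
      ((Equiv.subRight (1 : ℤ)).tsum_eq fun x => ‖ψ x 1‖ ^ 2)

/-- The time evolution operator `U = S C` of the quantum walk with coin `C`. -/
def evolution (C : ℤ → U2) : WalkSpace →L[ℂ] WalkSpace :=
  shiftOp.toContinuousLinearMap ∘L (coinOp C).toContinuousLinearMap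

/-- `U` acts as `(U ψ)(x) = P(x + 1) ψ(x + 1) + Q(x - 1) ψ(x - 1)`, where `P(x)` and `Q(x)` are the
upper and the lower row of `C(x)`. -/
lemma evolution_apply (C : ℤ → U2) (ψ : WalkSpace) (x : ℤ) :
    evolution C ψ x =
      !₂[(C (x + 1)).1 0 0 * ψ (x + 1) 0 + (C (x + 1)).1 0 1 * ψ (x + 1) 1,
        (C (x - 1)).1 1 0 * ψ (x - 1) 0 + (C (x - 1)).1 1 1 * ψ (x - 1) 1] := by
  ext i
  fin_cases i <;>
    simp [evolution, shiftOp, coinOp, Matrix.mulVec, dotProduct, Fin.sum_univ_two]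

/-- The eigenvalues of a bounded operator. -/
def pointSpectrum (T : WalkSpace →L[ℂ] WalkSpace) : Set ℂ :=
  {z | Module.End.HasEigenvalue (T : WalkSpace →ₗ[ℂ] WalkSpace) z}

/-- The discrete spectrum: isolated points of the spectrum that are eigenvalues of finite
multiplicity. -/
def discreteSpectrum (T : WalkSpace →L[ℂ] WalkSpace) : Set ℂ :=
  {z | z ∈ pointSpectrum T ∧
    FiniteDimensional ℂ (Module.End.eigenspace (T : WalkSpace →ₗ[ℂ] WalkSpace) z) ∧
    ∃ ε > 0, ∀ w ∈ spectrum ℂ T, dist w z < ε → w = z}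

/-- The essential spectrum: the complement of the discrete spectrum in the spectrum. -/
def essSpectrum (T : WalkSpace →L[ℂ] WalkSpace) : Set ℂ :=
  spectrum ℂ T \ discreteSpectrum T

/-- The matrix `C₀` of the position-independent walk. -/
def coinZero (p q α β γ : ℝ) : Matrix (Fin 2) (Fin 2) ℂ :=
  Complex.exp (Complex.I * (γ / 2)) •
    !![p * Complex.exp (Complex.I * (α - γ / 2)), q * Complex.exp (Complex.I * (β - γ / 2));
      -(q * Complex.exp (-(Complex.I * (β - γ / 2)))), p * Complex.exp (-(Complex.I * (α - γ / 2)))]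

/-- The anti-diagonal matrix `C₁` of an edge defect. -/
def coinOneMatrix (β' γ' : ℝ) : Matrix (Fin 2) (Fin 2) ℂ :=
  Complex.exp (Complex.I * (γ' / 2)) •
    !![0, Complex.exp (Complex.I * (β' - γ' / 2));
      -Complex.exp (-(Complex.I * (β' - γ' / 2))), 0]

lemma coinOneMatrix_mem (β' γ' : ℝ) :
    coinOneMatrix β' γ' ∈ Matrix.unitaryGroup (Fin 2) ℂ := by
  rw [Matrix.mem_unitaryGroup_iff]
  ext i j
  fin_cases i <;> fin_cases j <;>
    simp [coinOneMatrix, Matrix.mul_apply, Fin.sum_univ_two, Matrix.star_apply,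
      ← Complex.exp_conj, ← Complex.exp_add, map_ofNat] <;> ring_nf <;> simp

/-- `C₁` as an element of `U(2)`. -/
def coinOne (β' γ' : ℝ) : U2 := ⟨coinOneMatrix β' γ', coinOneMatrix_mem β' γ'⟩

/-- The largest modulus of an entry of a `2 × 2` matrix. -/
def maxEntryNorm (A : Matrix (Fin 2) (Fin 2) ℂ) : ℝ :=
  max (max ‖A 0 0‖ ‖A 0 1‖) (max ‖A 1 0‖ ‖A 1 1‖)

/-- `‖C(x) - C₀‖_∞ ≤ M exp(-ρ ⟨x⟩)` for all `x` with some constants `ρ, M > 0`. -/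
def ExpClose (C : ℤ → U2) (C₀ : Matrix (Fin 2) (Fin 2) ℂ) : Prop :=
  ∃ ρ M : ℝ, 0 < ρ ∧ 0 < M ∧
    ∀ x : ℤ, maxEntryNorm ((C x).1 - C₀) ≤ M * Real.exp (-ρ * Real.sqrt (1 + (x : ℝ) ^ 2))

/-- The edge `e_y = {y - 1, y}`. -/
def edge (y : ℤ) : Set ℤ := {y - 1, y}

/-- `e_y` is an edge defect of the coin `C`. -/
def IsEdgeDefect (C : ℤ → U2) (y : ℤ) : Prop :=
  ∃ β' ∈ Set.Ico 0 (2 * Real.pi), ∃ γ' ∈ Set.Ico 0 (2 * Real.pi),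
    ∀ x ∈ edge y, (C x).1 = coinOneMatrix β' γ'

/-- The union of the edges `e_y`, `y ∈ Y`. -/
def edgeUnion (Y : Finset ℤ) : Set ℤ := ⋃ y ∈ Y, edge y

open Classical in
/-- The coin `F_e C₁ + (1 - F_e) C₂`, for which `C = C₁` on `e` and `C = C₂` off `e`. -/
def defectCoin (e : Set ℤ) (C₁ : U2) (C₂ : ℤ → U2) : ℤ → U2 :=
  fun x => if x ∈ e then C₁ else C₂ x

/-- The set `J_γ`, which depends on `p` and `γ`. -/
def bandAngles (p γ : ℝ) : Set ℝ :=
  Set.Icc (Real.arccos p + γ / 2) (Real.pi - Real.arccos p + γ / 2) ∪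
    Set.Icc (Real.pi + Real.arccos p + γ / 2) (2 * Real.pi - Real.arccos p + γ / 2)

/-- The set `J_{γ,𝒯}` of the end points of the two intervals of `J_γ`. -/
def thresholdAngles (p γ : ℝ) : Set ℝ :=
  {Real.arccos p + γ / 2, Real.pi - Real.arccos p + γ / 2,
    Real.pi + Real.arccos p + γ / 2, 2 * Real.pi - Real.arccos p + γ / 2}

/-- The set `𝒯` of thresholds in the essential spectrum of `T`. -/
def thresholds (p γ : ℝ) (T : WalkSpace →L[ℂ] WalkSpace) : Set ℂ :=
  {z | z ∈ essSpectrum T ∧ ∃ θ ∈ thresholdAngles p γ, z = Complex.exp (Complex.I * θ)}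

end

/-! Write the spectral parameter as z = gζ with g = e^{iγ/2} and |ζ| = 1. The position of z is then
decided by |Re ζ|: interior of the bands for |Re ζ| < p, threshold angles for |Re ζ| = p, gaps for
|Re ζ| > p.

If no edge is present, C = C₂, and each kind of eigenvalue is dealt with separately. For |Re ζ| < p
the transfer matrix of C₀ is elliptic and C₂ is a summable perturbation, so a nonzero eigenvector
could not decay (`IsPhaseMul.notMem_pointSpectrum`). For |Re ζ| = p, a point of the essential
spectrum lies in 𝒯 and is excluded. For |Re ζ| > p, U - z is bounded below up to a finite-rank term,
and normality of U makes the eigenvalue discrete (`IsPhaseMul.mem_discreteSpectrum`).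

If an edge is present, its anti-diagonal coins trap a state bouncing between the two sites, which
yields the eigenvalues ±e^{i(γ'+π)/2} (`mem_pointSpectrum_of_edge`). The assumption on γ' puts one
of them inside a band, where truncated plane waves far from the origin show that a whole arc is
spectrum (`IsPhaseMul.mem_essSpectrum`).

The equivalence with edge defects only compares diagonals: C₁ has zero diagonal, while a₂ never
vanishes. -/

noncomputable section

/-! ### Normal operators bounded below up to a finite-rank term -/

section Operators

lemma isStarNormal_sub_algebraMap {A : Type*} [Ring A] [StarRing A] [Algebra ℂ A] [StarModule ℂ A]
    {T : A} (hT : IsStarNormal T) (w : ℂ) : IsStarNormal (T - algebraMap ℂ A w) := by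
  refine ⟨?_⟩
  have h1 := hT.star_comm_self
  simp only [Commute, SemiconjBy, star_sub, ← algebraMap_star_comm, sub_mul, mul_sub] at h1 ⊢
  rw [h1, Algebra.commutes (star w) T, Algebra.commutes w (star T),
    Algebra.commutes w (algebraMap ℂ A (star w))]
  abel

variable {H F : Type*} [NormedAddCommGroup H] [InnerProductSpace ℂ H] [CompleteSpace H]
  [NormedAddCommGroup F] [NormedSpace ℂ F] [FiniteDimensional ℂ F]

/-- On the kernel of T the estimate forces K to be injective into a finite-dimensional space. -/
lemma finiteDimensional_ker_of_norm_le {H F : Type*} [NormedAddCommGroup H] [NormedSpace ℂ H]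
    [NormedAddCommGroup F] [NormedSpace ℂ F] [FiniteDimensional ℂ F] (T : H →L[ℂ] H) (K : H →L[ℂ] F) {A B : ℝ}
    (h : ∀ φ, ‖φ‖ ≤ A * ‖T φ‖ + B * ‖K φ‖) :
    FiniteDimensional ℂ (LinearMap.ker (T : H →ₗ[ℂ] H)) := by
  refine FiniteDimensional.of_injective
    ((K : H →ₗ[ℂ] F).comp (LinearMap.ker (T : H →ₗ[ℂ] H)).subtype) ?_
  refine (injective_iff_map_eq_zero _).2 fun φ hφ => ?_
  have hT : T φ = 0 := φ.2
  have hK : K φ = 0 := hφ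
  have := h φ
  rw [hT, hK] at this
  exact Subtype.ext (norm_le_zero_iff.1 (by simpa using this))

/-- Compactness: otherwise there are unit vectors orthogonal to the kernel with Tφₙ → 0. Along a
subsequence Kφₙ converges, and the estimate applied to differences makes φₙ Cauchy. The limit is a
unit vector lying both in the kernel and in its orthogonal complement. -/
lemma exists_norm_le_of_mem_orthogonal_ker (T : H →L[ℂ] H) (K : H →L[ℂ] F) {A B : ℝ}
    (h : ∀ φ, ‖φ‖ ≤ A * ‖T φ‖ + B * ‖K φ‖) :
    ∃ c > 0, ∀ φ ∈ (LinearMap.ker (T : H →ₗ[ℂ] H))ᗮ, c * ‖φ‖ ≤ ‖T φ‖ := by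
  by_contra! hcon
  have hseq : ∀ n : ℕ, ∃ φ ∈ (LinearMap.ker (T : H →ₗ[ℂ] H))ᗮ,
      ‖φ‖ = 1 ∧ ‖T φ‖ ≤ 1 / ((n : ℝ) + 1) := by
    intro n
    obtain ⟨φ, hφ, hlt⟩ := hcon (1 / ((n : ℝ) + 1)) (by positivity)
    have h0 : φ ≠ 0 := by
      rintro rfl
      simp at hlt
    have hpos : 0 < ‖φ‖ := norm_pos_iff.2 h0
    refine ⟨((‖φ‖⁻¹ : ℝ) : ℂ) • φ, Submodule.smul_mem _ _ hφ, ?_, ?_⟩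
    · rw [norm_smul, Complex.norm_real, norm_inv, norm_norm, inv_mul_cancel₀ hpos.ne']
    · rw [map_smul, norm_smul, Complex.norm_real, norm_inv, norm_norm, inv_mul_le_iff₀ hpos,
        mul_comm]
      exact hlt.le
  choose φ hφ hφ1 hTφ using hseq
  have hT0 : Filter.Tendsto (fun n => T (φ n)) Filter.atTop (nhds 0) :=
    squeeze_zero_norm hTφ tendsto_one_div_add_atTop_nhds_zero_nat
  have hKb : ∀ n, K (φ n) ∈ Metric.closedBall (0 : F) ‖K‖ := fun n => by
    have := K.le_opNorm (φ n)
    rw [hφ1 n, mul_one] at this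
    simpa using this
  have : ProperSpace F := FiniteDimensional.proper ℂ F
  obtain ⟨f, -, s, hs, hsf⟩ := (isCompact_closedBall (0 : F) ‖K‖).tendsto_subseq hKb
  have hTs : Filter.Tendsto (fun n => T (φ (s n))) Filter.atTop (nhds 0) :=
    hT0.comp hs.tendsto_atTop
  have hC : CauchySeq (fun n => φ (s n)) := by
    have h1 := hTs.cauchySeq
    have h2 : CauchySeq (fun n => K (φ (s n))) := hsf.cauchySeq
    rw [cauchySeq_iff_tendsto_dist_atTop_0] at h1 h2 ⊢
    have h3 := (h1.const_mul A).add (h2.const_mul B)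
    simp only [mul_zero, add_zero] at h3
    refine squeeze_zero (fun _ => dist_nonneg) (fun n => ?_) h3
    simp only [dist_eq_norm, ← map_sub]
    exact h _
  obtain ⟨ψ, hψ⟩ := cauchySeq_tendsto_of_complete hC
  have hψ1 : ‖ψ‖ = 1 := tendsto_nhds_unique hψ.norm (by simp [hφ1])
  have hTψ : T ψ = 0 := tendsto_nhds_unique ((T.continuous.tendsto ψ).comp hψ) hTs
  have hmem : ψ ∈ (LinearMap.ker (T : H →ₗ[ℂ] H))ᗮ :=
    (Submodule.isClosed_orthogonal _).mem_of_tendsto hψ (Filter.Eventually.of_forall fun n => hφ _)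
  have h0 : inner ℂ ψ ψ = 0 := hmem ψ hTψ
  rw [inner_self_eq_zero] at h0
  simp [h0] at hψ1

lemma isUnit_of_isStarNormal_of_norm_le (T : H →L[ℂ] H) (hT : IsStarNormal T) {c : ℝ}
    (hc : 0 < c) (h : ∀ φ, c * ‖φ‖ ≤ ‖T φ‖) : IsUnit T := by
  have hanti : AntilipschitzWith (Real.toNNReal c⁻¹) T := by
    refine AddMonoidHomClass.antilipschitz_of_bound T fun φ => ?_
    rw [Real.coe_toNNReal _ (by positivity), ← div_eq_inv_mul, le_div_iff₀ hc, mul_comm]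
    exact h φ
  rw [ContinuousLinearMap.isUnit_iff_bijective,
    ContinuousLinearMap.bijective_iff_dense_range_and_antilipschitz]
  refine ⟨?_, _, hanti⟩
  rw [Submodule.topologicalClosure_eq_top_iff, ContinuousLinearMap.IsStarNormal.orthogonal_range hT]
  exact LinearMap.ker_eq_bot.2 hanti.injective

/-- For normal T the kernel and its orthogonal complement are both invariant. T - w is -w on the
former and bounded below by c - |w| on the latter, so 0 is at most an isolated spectral point. -/
lemma exists_isUnit_sub_algebraMap (T : H →L[ℂ] H) (hT : IsStarNormal T) (K : H →L[ℂ] F)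
    {A B : ℝ} (h : ∀ φ, ‖φ‖ ≤ A * ‖T φ‖ + B * ‖K φ‖) :
    ∃ ε > 0, ∀ w : ℂ, w ≠ 0 → ‖w‖ < ε → IsUnit (T - algebraMap ℂ (H →L[ℂ] H) w) := by
  obtain ⟨c, hc, hcT⟩ := exists_norm_le_of_mem_orthogonal_ker T K h
  -- With |w| < c/2 one has c - |w| ≥ |w|, so |w| is a lower bound on both summands.
  refine ⟨c / 2, by positivity, fun w hw hwc => ?_⟩
  have hn := isStarNormal_sub_algebraMap hT w
  have hw0 : 0 < ‖w‖ := norm_pos_iff.2 hw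
  refine isUnit_of_isStarNormal_of_norm_le _ hn (c := ‖w‖) hw0 fun φ => ?_
  set P := LinearMap.ker (T : H →ₗ[ℂ] H) with hP
  have : CompleteSpace P := T.isClosed_ker.completeSpace_coe
  obtain ⟨φ₁, h₁, φ₂, h₂, rfl⟩ := P.exists_add_mem_mem_orthogonal φ
  have hT1 : T φ₁ = 0 := h₁
  have hTo : T φ₂ ∈ Pᗮ := by
    intro η hη
    rw [← ContinuousLinearMap.adjoint_inner_left]
    have : ContinuousLinearMap.adjoint T η = 0 :=
      (ContinuousLinearMap.IsStarNormal.adjoint_apply_eq_zero_iff hT η).2 hη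
    rw [this, inner_zero_left]
  have e : (T - algebraMap ℂ (H →L[ℂ] H) w) (φ₁ + φ₂) = -(w • φ₁) + (T φ₂ - w • φ₂) := by
    simp [Algebra.algebraMap_eq_smul_one, hT1]
    abel
  rw [e]
  have i1 : inner ℂ (-(w • φ₁)) (T φ₂ - w • φ₂) = 0 :=
    (Pᗮ.sub_mem hTo (Pᗮ.smul_mem w h₂)) _ (P.neg_mem (P.smul_mem w h₁))
  have i2 : inner ℂ φ₁ φ₂ = 0 := h₂ _ h₁
  have p1 := norm_add_sq_eq_norm_sq_add_norm_sq_of_inner_eq_zero _ _ i1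
  have p2 := norm_add_sq_eq_norm_sq_add_norm_sq_of_inner_eq_zero _ _ i2
  rw [norm_neg, norm_smul] at p1
  have b : ‖w‖ * ‖φ₂‖ ≤ ‖T φ₂ - w • φ₂‖ := by
    have := norm_sub_norm_le (T φ₂) (w • φ₂)
    rw [norm_smul] at this
    have := hcT φ₂ h₂
    nlinarith [norm_nonneg φ₂]
  have b2 := mul_self_le_mul_self (by positivity) b
  refine abs_le_of_sq_le_sq' ?_ (norm_nonneg _) |>.2
  rw [mul_pow, sq ‖φ₁ + φ₂‖, p2, sq ‖-(w • φ₁) + _‖, p1]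
  linarith

end Operators

/-! ### Perturbed elliptic recurrences -/

section Elliptic

variable {E : Type*} [NormedAddCommGroup E] [NormedSpace ℂ E]

/-- The inequality gives N(n+1) ≥ (1 - 2eₙ) N(n) once eₙ is small. The product of these factors
stays away from zero because e is summable, so N tends to zero only if it vanishes somewhere. -/
lemma eventually_zero_of_mul_le {N e : ℕ → ℝ} (hN : ∀ n, 0 ≤ N n) (he : ∀ n, 0 ≤ e n)
    (hs : Summable e) (h : ∀ n, N n ≤ N (n + 1) + e n * (N n + N (n + 1)))
    (h0 : Filter.Tendsto N Filter.atTop (nhds 0)) : ∃ n, N n = 0 := by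
  -- A tail sum below 1/4 keeps the factor 1 - 2∑e in `key` above 1/2.
  obtain ⟨m, hm⟩ : ∃ m, ∑' k, e (k + m) < 1 / 4 :=
    ((tendsto_sum_nat_add e).eventually (gt_mem_nhds (by norm_num))).exists
  have hs' : Summable fun k => e (k + m) := (summable_nat_add_iff m).2 hs
  have hsum : ∀ n, ∑ k ∈ Finset.range n, e (k + m) < 1 / 4 := fun n =>
    (hs'.sum_le_tsum _ fun _ _ => he _).trans_lt hm
  have key : ∀ n, (1 - 2 * ∑ k ∈ Finset.range n, e (k + m)) * N m ≤ N (n + m) := by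
    intro n
    induction n with
    | zero => simp
    | succ n ih =>
      have h1 := h (n + m)
      have h2 := he (n + m)
      have h3 := hsum n
      have h4 := hsum (n + 1)
      have h5 : 0 ≤ ∑ k ∈ Finset.range n, e (k + m) := Finset.sum_nonneg fun _ _ => he _
      rw [Finset.sum_range_succ] at h4 ⊢
      rw [show n + 1 + m = n + m + 1 by ring]
      set s := ∑ k ∈ Finset.range n, e (k + m)
      set t := e (n + m)
      have h6 : (1 - 2 * t) * N (n + m) ≤ N (n + m + 1) := by
        have : (1 - t) * N (n + m) ≤ (1 + t) * N (n + m + 1) := by linarith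
        have h7 : (1 - t) * ((1 - t) * N (n + m)) ≤ (1 - t) * ((1 + t) * N (n + m + 1)) :=
          mul_le_mul_of_nonneg_left this (by linarith)
        nlinarith [hN (n + m), hN (n + m + 1), mul_nonneg (mul_nonneg h2 h2) (hN (n + m)),
          mul_nonneg (mul_nonneg h2 h2) (hN (n + m + 1))]
      refine le_trans ?_ h6
      have h8 : (1 - 2 * t) * ((1 - 2 * s) * N m) ≤ (1 - 2 * t) * N (n + m) :=
        mul_le_mul_of_nonneg_left ih (by linarith)
      refine le_trans ?_ h8
      nlinarith [mul_nonneg (mul_nonneg h2 h5) (hN m)]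
  refine ⟨m, le_antisymm ?_ (hN m)⟩
  have hlim : Filter.Tendsto (fun n => N (n + m)) Filter.atTop (nhds 0) :=
    (Filter.tendsto_add_atTop_iff_nat m).2 h0
  have : 1 / 2 * N m ≤ 0 := ge_of_tendsto' hlim fun n => by
    refine le_trans ?_ (key n)
    exact mul_le_mul_of_nonneg_right (by linarith [hsum n]) (hN m)
  linarith

/-- Solutions of a summable perturbation of an elliptic recurrence do not tend to zero. -/
lemma exists_eq_zero_of_elliptic (T : E →L[ℂ] E) {a b : ℂ} (hab : a ≠ b) (ha : ‖a‖ = 1)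
    (hb : ‖b‖ = 1) (hT : ∀ w, T (T w) = (a + b) • T w - (a * b) • w) {w : ℕ → E} {e : ℕ → ℝ}
    (he : ∀ n, 0 ≤ e n) (hs : Summable e)
    (h : ∀ n, ‖w (n + 1) - T (w n)‖ ≤ e n * (‖w n‖ + ‖w (n + 1)‖))
    (h0 : Filter.Tendsto w Filter.atTop (nhds 0)) : ∃ n, w n = 0 := by
  -- A norm equivalent to the given one and preserved by T: by the quadratic relation, T multiplies
  -- Tv - av by b and Tv - bv by a, both of modulus 1. Definiteness comes from a ≠ b.
  let N : E → ℝ := fun v => ‖T v - a • v‖ + ‖T v - b • v‖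
  have hNT : ∀ v, N (T v) = N v := by
    intro v
    have h1 : T (T v) - a • T v = b • (T v - a • v) := by
      rw [hT]; module
    have h2 : T (T v) - b • T v = a • (T v - b • v) := by
      rw [hT]; module
    simp only [N, h1, h2, norm_smul, ha, hb, one_mul]
  set D := 2 * (‖T‖ + 1) with hD
  have hDpos : 0 < D := by positivity
  have hup : ∀ v, N v ≤ D * ‖v‖ := by
    intro v
    have h1 := norm_sub_le (T v) (a • v)
    have h2 := norm_sub_le (T v) (b • v)
    rw [norm_smul, ha] at h1
    rw [norm_smul, hb] at h2
    have := T.le_opNorm v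
    simp only [N]
    linarith
  have hpos : 0 < ‖a - b‖ := norm_pos_iff.2 (sub_ne_zero.2 hab)
  have hlow : ∀ v, ‖a - b‖ * ‖v‖ ≤ N v := by
    intro v
    rw [← norm_smul, show (a - b) • v = (T v - b • v) - (T v - a • v) by module]
    exact (norm_sub_le _ _).trans (by simp only [N]; linarith)
  have htri : ∀ u v, N u ≤ N v + N (v - u) := by
    intro u v
    have h1 := norm_sub_le (T v - a • v) (T (v - u) - a • (v - u))
    have h2 := norm_sub_le (T v - b • v) (T (v - u) - b • (v - u))
    rw [show T v - a • v - (T (v - u) - a • (v - u)) = T u - a • u by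
      rw [map_sub]; module] at h1
    rw [show T v - b • v - (T (v - u) - b • (v - u)) = T u - b • u by
      rw [map_sub]; module] at h2
    simp only [N]
    linarith
  obtain ⟨n, hn⟩ := eventually_zero_of_mul_le (N := fun n => N (w n))
    (e := fun n => D / ‖a - b‖ * e n) (fun n => by positivity)
    (fun n => mul_nonneg (by positivity) (he n)) (hs.mul_left _) (fun n => by
      have h1 := htri (T (w n)) (w (n + 1))
      rw [hNT] at h1
      refine h1.trans ?_
      gcongr
      refine (hup _).trans ?_
      refine (mul_le_mul_of_nonneg_left (h n) hDpos.le).trans ?_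
      have h2 := hlow (w n)
      have h3 := hlow (w (n + 1))
      rw [div_mul_eq_mul_div, div_mul_eq_mul_div, le_div_iff₀ hpos, mul_assoc D, mul_assoc D,
        mul_assoc (e n)]
      refine mul_le_mul_of_nonneg_left (mul_le_mul_of_nonneg_left ?_ (he n)) hDpos.le
      linarith)
    (squeeze_zero (fun n => by positivity) (fun n => hup (w n))
      (by simpa using h0.norm.const_mul D))
  refine ⟨n, norm_le_zero_iff.1 ?_⟩
  have := hlow (w n)
  rw [hn] at this
  exact nonpos_of_mul_nonpos_right this hpos

end Elliptic

/-! ### Unitarity and locality of the walk -/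

section Walk

lemma shiftOp_surjective : Function.Surjective shiftOp := by
  intro φ
  have hm : Memℓp (fun x : ℤ => (!₂[φ (x - 1) 0, φ (x + 1) 1] : EuclideanSpace ℂ (Fin 2))) 2 := by
    refine walk_memℓp _ ?_
    have h0 := (Equiv.subRight (1 : ℤ)).summable_iff.2 (walk_summable_coord φ 0)
    have h1 := (Equiv.addRight (1 : ℤ)).summable_iff.2 (walk_summable_coord φ 1)
    refine (h0.add h1).congr fun x => ?_
    simp [EuclideanSpace.norm_sq_eq]
  refine ⟨⟨_, hm⟩, ?_⟩
  ext x i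
  fin_cases i <;> simp [shiftOp]

lemma coinOp_surjective (C : ℤ → U2) : Function.Surjective (coinOp C) := by
  intro φ
  refine ⟨coinOp (fun x => (C x)⁻¹) φ, ?_⟩
  ext1
  funext x
  change Matrix.toEuclideanCLM (n := Fin 2) (𝕜 := ℂ) (C x).1
    (Matrix.toEuclideanCLM (n := Fin 2) (𝕜 := ℂ) ((C x)⁻¹).1 (φ x)) = φ x
  have h := congrArg (fun A => A (φ x)) (map_mul (Matrix.toEuclideanCLM (n := Fin 2) (𝕜 := ℂ))
    (C x).1 ((C x)⁻¹).1)
  rw [← Submonoid.coe_mul, mul_inv_cancel] at h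
  simpa using h.symm

lemma norm_evolution (C : ℤ → U2) (ψ : WalkSpace) : ‖evolution C ψ‖ = ‖ψ‖ := by
  simp [evolution]

lemma evolution_mem_unitary (C : ℤ → U2) :
    evolution C ∈ unitary (WalkSpace →L[ℂ] WalkSpace) := by
  have h1 : ContinuousLinearMap.adjoint (evolution C) * evolution C = 1 :=
    ContinuousLinearMap.norm_map_iff_adjoint_comp_self _ |>.1 (norm_evolution C)
  have hs : Function.Surjective (evolution C) :=
    shiftOp_surjective.comp (coinOp_surjective C)
  refine Unitary.mem_iff.2 ⟨h1, ?_⟩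
  ext1 φ
  obtain ⟨ψ, rfl⟩ := hs φ
  have := congrArg (fun A : WalkSpace →L[ℂ] WalkSpace => evolution C (A ψ)) h1
  simpa [ContinuousLinearMap.star_eq_adjoint] using this

lemma isStarNormal_evolution_sub (C : ℤ → U2) (w : ℂ) :
    IsStarNormal (evolution C - algebraMap ℂ (WalkSpace →L[ℂ] WalkSpace) w) := by
  have h := Unitary.mem_iff.1 (evolution_mem_unitary C)
  exact isStarNormal_sub_algebraMap ⟨h.1.trans h.2.symm⟩ w

/-- The action of a matrix on `ℂ²`. -/
abbrev coinAct (A : U2) (v : EuclideanSpace ℂ (Fin 2)) : EuclideanSpace ℂ (Fin 2) :=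
  Matrix.toEuclideanCLM (n := Fin 2) (𝕜 := ℂ) A.1 v

lemma coinAct_apply (A : U2) (v : EuclideanSpace ℂ (Fin 2)) (i : Fin 2) :
    coinAct A v i = A.1 i 0 * v 0 + A.1 i 1 * v 1 := by
  simp [coinAct, Matrix.mulVec, dotProduct, Fin.sum_univ_two]

lemma norm_evolution_sub_evolution (C D : ℤ → U2) (φ : WalkSpace) :
    ‖evolution C φ - evolution D φ‖ = ‖coinOp C φ - coinOp D φ‖ := by
  rw [← shiftOp.norm_map (coinOp C φ - coinOp D φ), map_sub]
  rfl

/-- Evaluation of a state on a finite set of positions. -/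
def restrictTo (s : Finset ℤ) : WalkSpace →L[ℂ] (s → EuclideanSpace ℂ (Fin 2)) :=
  LinearMap.mkContinuous
    { toFun := fun φ x => φ x
      map_add' := fun _ _ => rfl
      map_smul' := fun _ _ => rfl } 1 fun φ => by
    rw [one_mul]
    exact (pi_norm_le_iff_of_nonneg (norm_nonneg _)).2 fun x =>
      lp.norm_apply_le_norm (by norm_num) φ x

/-- The shift is isometric, so the difference is computed site by site. On s two unitary coins
differ by at most a factor 2, and these finitely many sites form the finite-rank error. -/
lemma norm_evolution_sub_evolution_le (C D : ℤ → U2) (s : Finset ℤ) {ε : ℝ} (hε : 0 ≤ ε)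
    (h : ∀ x ∉ s, ∀ v, ‖coinAct (C x) v - coinAct (D x) v‖ ≤ ε * ‖v‖) (φ : WalkSpace) :
    ‖evolution C φ - evolution D φ‖ ≤ ε * ‖φ‖ + 2 * Real.sqrt s.card * ‖restrictTo s φ‖ := by
  rw [norm_evolution_sub_evolution]
  have hsq : ‖coinOp C φ - coinOp D φ‖ ^ 2 ≤ ε ^ 2 * ‖φ‖ ^ 2 + 4 * ∑ x ∈ s, ‖φ x‖ ^ 2 := by
    rw [walk_norm_sq, walk_norm_sq, ← tsum_mul_left, Finset.mul_sum]
    have hs1 := (walk_summable φ).mul_left (ε ^ 2)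
    have hs2 : Summable fun x : ℤ => if x ∈ s then 4 * ‖φ x‖ ^ 2 else 0 :=
      summable_of_ne_finset_zero (s := s) fun x hx => if_neg hx
    have e2 : ∑' x : ℤ, (if x ∈ s then 4 * ‖φ x‖ ^ 2 else 0) = ∑ x ∈ s, 4 * ‖φ x‖ ^ 2 := by
      rw [tsum_eq_sum (s := s) fun x hx => if_neg hx]
      exact Finset.sum_congr rfl fun x hx => if_pos hx
    rw [← e2, ← hs1.tsum_add hs2]
    refine (walk_summable _).tsum_le_tsum (fun x => ?_) (hs1.add hs2)
    change ‖coinAct (C x) (φ x) - coinAct (D x) (φ x)‖ ^ 2 ≤ _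
    split_ifs with hx
    · have h1 := norm_sub_le (coinAct (C x) (φ x)) (coinAct (D x) (φ x))
      rw [norm_toEuclideanCLM_unitary, norm_toEuclideanCLM_unitary] at h1
      have h2 := pow_le_pow_left₀ (norm_nonneg _) h1 2
      nlinarith [mul_nonneg (sq_nonneg ε) (sq_nonneg ‖φ x‖)]
    · rw [add_zero, ← mul_pow]
      exact pow_le_pow_left₀ (norm_nonneg _) (h x hx _) 2
  have hK : ∑ x ∈ s, ‖φ x‖ ^ 2 ≤ s.card * ‖restrictTo s φ‖ ^ 2 := by
    rw [← nsmul_eq_mul]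
    refine Finset.sum_le_card_nsmul _ _ _ fun x hx => ?_
    exact pow_le_pow_left₀ (norm_nonneg _) (norm_le_pi_norm (restrictTo s φ) ⟨x, hx⟩) 2
  refine abs_le_of_sq_le_sq' ?_ (by positivity) |>.2
  have h3 : (2 * Real.sqrt s.card * ‖restrictTo s φ‖) ^ 2 =
      4 * (s.card * ‖restrictTo s φ‖ ^ 2) := by
    rw [mul_pow, mul_pow, Real.sq_sqrt (by positivity)]
    ring
  have h4 : 0 ≤ (ε * ‖φ‖) * (2 * Real.sqrt s.card * ‖restrictTo s φ‖) := by positivity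
  nlinarith

lemma evolution_single (C : ℤ → U2) (x : ℤ) (v : EuclideanSpace ℂ (Fin 2)) :
    evolution C (lp.single 2 x v) =
      lp.single (E := fun _ : ℤ => EuclideanSpace ℂ (Fin 2)) 2 (x - 1) !₂[coinAct (C x) v 0, 0] +
      lp.single (E := fun _ : ℤ => EuclideanSpace ℂ (Fin 2)) 2 (x + 1)
        !₂[0, coinAct (C x) v 1] := by
  ext1
  funext y
  rw [evolution_apply, lp.coeFn_add, Pi.add_apply]
  ext i
  rw [PiLp.add_apply]
  simp only [lp.single_apply, coinAct_apply]
  fin_cases i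
  · have e : y = x - 1 ↔ y + 1 = x := by omega
    by_cases h : y + 1 = x
    · have h2 : y ≠ x + 1 := by omega
      simp [Pi.single_apply, e, h, h2]
    · simp only [Pi.single_apply, e, if_neg h]
      split_ifs <;> simp
  · have e : y = x + 1 ↔ y - 1 = x := by omega
    by_cases h : y - 1 = x
    · have h2 : y ≠ x - 1 := by omega
      simp [Pi.single_apply, e, h, h2]
    · simp only [Pi.single_apply, e, if_neg h]
      split_ifs <;> simp

/-- Translation of states by `n` positions. -/
def walkTranslate (n : ℤ) : WalkSpace →ₗᵢ[ℂ] WalkSpace where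
  toFun ψ := ⟨fun x => ψ (x + n),
    walk_memℓp _ ((Equiv.addRight n).summable_iff.2 (walk_summable ψ))⟩
  map_add' _ _ := rfl
  map_smul' _ _ := rfl
  norm_map' ψ := by
    refine (sq_eq_sq₀ (norm_nonneg _) (norm_nonneg _)).1 ?_
    rw [walk_norm_sq, walk_norm_sq]
    exact (Equiv.addRight n).tsum_eq fun x => ‖ψ x‖ ^ 2

end Walk

/-- `A = g B` with `|g| = 1` and `B ∈ SU(2)` with first row `(a, b)`, where `a ≠ 0`. -/
structure IsPhaseMul (A : Matrix (Fin 2) (Fin 2) ℂ) (g a b : ℂ) : Prop where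
  norm_phase : ‖g‖ = 1
  norm_row : ‖a‖ ^ 2 + ‖b‖ ^ 2 = 1
  ne_zero : a ≠ 0
  entry00 : A 0 0 = g * a
  entry01 : A 0 1 = g * b
  entry10 : A 1 0 = -(g * star b)
  entry11 : A 1 1 = g * star a

/-! ### The position-independent walk -/

namespace IsPhaseMul

variable {D : U2} {g a b : ℂ}

lemma star_mul_row {A : Matrix (Fin 2) (Fin 2) ℂ} (h : IsPhaseMul A g a b) :
    a * star a + b * star b = 1 := by
  have := congrArg (fun x : ℝ => (x : ℂ)) h.norm_row
  simpa [Complex.mul_conj, Complex.normSq_eq_norm_sq] using this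

/-- Cayley–Hamilton in momentum space: the symbol of U is a 2 × 2 matrix of determinant g² and trace
g(ae^{ik} + āe^{-ik}). -/
lemma evolution_evolution (h : IsPhaseMul D.1 g a b) (ψ : WalkSpace) :
    evolution (fun _ => D) (evolution (fun _ => D) ψ) + g ^ 2 • ψ =
      g • (a • walkTranslate 1 (evolution (fun _ => D) ψ) +
        star a • walkTranslate (-1) (evolution (fun _ => D) ψ)) := by
  have hr := h.star_mul_row
  ext1
  funext x
  ext i
  set χ := evolution (fun _ => D) ψ with hχ
  change evolution (fun _ => D) χ x i + g ^ 2 * ψ x i =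
    g * (a * χ (x + 1) i + star a * χ (x + -1) i)
  rw [← sub_eq_add_neg x 1, evolution_apply, hχ, evolution_apply, evolution_apply]
  fin_cases i <;>
    simp [h.entry00, h.entry01, h.entry10, h.entry11] at hr ⊢
  · linear_combination -g ^ 2 * ψ x 0 * hr
  · linear_combination -g ^ 2 * ψ x 1 * hr

/-- By the quadratic relation, (U - gζ̄)(U - gζ) = g(aτ + āτ⁻¹ - 2 Re ζ)U with τ the translation.
The first factor has norm at most 2, and the right side is at least 2(|Re ζ| - |a|)‖ψ‖. -/
lemma mul_norm_le_norm_evolution_sub (h : IsPhaseMul D.1 g a b) {ζ : ℂ} (hζ : ‖ζ‖ = 1)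
    (ψ : WalkSpace) :
    (|ζ.re| - ‖a‖) * ‖ψ‖ ≤ ‖evolution (fun _ => D) ψ - (g * ζ) • ψ‖ := by
  set U := evolution (fun _ => D) with hU
  set η := U ψ - (g * ζ) • ψ with hη
  have hre : ζ + star ζ = ((2 * ζ.re : ℝ) : ℂ) := by
    simpa using Complex.add_conj ζ
  have hn : ζ * star ζ = 1 := by
    simp [Complex.mul_conj, Complex.normSq_eq_norm_sq, hζ]
  have e : U η - (g * star ζ) • η = g • ((a • walkTranslate 1 (U ψ) +
        star a • walkTranslate (-1) (U ψ)) - ((2 * ζ.re : ℝ) : ℂ) • U ψ) := by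
    rw [smul_sub g, ← h.evolution_evolution ψ, ← hU, ← hre, hη, map_sub, map_smul]
    have : g ^ 2 • ψ = (g ^ 2 * (ζ * star ζ)) • ψ := by rw [hn, mul_one]
    rw [this]
    module
  have h1 : ‖U η - (g * star ζ) • η‖ ≤ 2 * ‖η‖ := by
    refine (norm_sub_le _ _).trans ?_
    rw [norm_smul, norm_mul, h.norm_phase, norm_star, hζ, norm_evolution]
    linarith
  have h2 : ‖a • walkTranslate 1 (U ψ) + star a • walkTranslate (-1) (U ψ)‖ ≤ 2 * ‖a‖ * ‖ψ‖ := by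
    refine (norm_add_le _ _).trans ?_
    rw [norm_smul, norm_smul, norm_star, LinearIsometry.norm_map, LinearIsometry.norm_map,
      norm_evolution]
    linarith
  have h3 : ‖((2 * ζ.re : ℝ) : ℂ) • U ψ‖ = 2 * |ζ.re| * ‖ψ‖ := by
    rw [norm_smul, norm_evolution, Complex.norm_real, Real.norm_eq_abs, abs_mul, abs_two]
  rw [e, norm_smul, h.norm_phase, one_mul, norm_sub_rev] at h1
  have h4 := norm_sub_norm_le (((2 * ζ.re : ℝ) : ℂ) • U ψ)
    (a • walkTranslate 1 (U ψ) + star a • walkTranslate (-1) (U ψ))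
  rw [h3] at h4
  linarith

end IsPhaseMul

/-- The coin `C` converges to `D` at infinity. -/
def CoinTendsTo (C : ℤ → U2) (D : U2) : Prop :=
  ∀ ε > 0, ∃ s : Finset ℤ, ∀ x ∉ s, ∀ v, ‖coinAct (C x) v - coinAct D v‖ ≤ ε * ‖v‖

lemma exists_eigenvector_of_mem_pointSpectrum {C : ℤ → U2} {z : ℂ}
    (hz : z ∈ pointSpectrum (evolution C)) :
    ∃ ψ : WalkSpace, ψ ≠ 0 ∧ evolution C ψ = z • ψ := by
  obtain ⟨ψ, hψ⟩ := Module.End.HasEigenvalue.exists_hasEigenvector hz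
  exact ⟨ψ, hψ.2, hψ.apply_eq_smul⟩

lemma mem_pointSpectrum_of_eigenvector {C : ℤ → U2} {z : ℂ} {ψ : WalkSpace} (h0 : ψ ≠ 0)
    (h : evolution C ψ = z • ψ) : z ∈ pointSpectrum (evolution C) :=
  Module.End.hasEigenvalue_of_hasEigenvector ⟨Module.End.mem_eigenspace_iff.2 h, h0⟩

lemma norm_eq_one_of_mem_pointSpectrum {C : ℤ → U2} {z : ℂ}
    (hz : z ∈ pointSpectrum (evolution C)) : ‖z‖ = 1 := by
  obtain ⟨ψ, h0, h⟩ := exists_eigenvector_of_mem_pointSpectrum hz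
  have := norm_evolution C ψ
  rw [h, norm_smul] at this
  exact mul_right_cancel₀ (norm_ne_zero_iff.2 h0) (by rw [this, one_mul])

/-! ### Gaps, dispersion relation and transfer equations -/

namespace IsPhaseMul

variable {D : U2} {g a b ζ : ℂ} {C : ℤ → U2}

lemma norm_le_of_abs_re_gt (h : IsPhaseMul D.1 g a b) (hC : CoinTendsTo C D) (hζ : ‖ζ‖ = 1)
    (hre : ‖a‖ < |ζ.re|) : ∃ (s : Finset ℤ) (A B : ℝ), ∀ φ : WalkSpace,
      ‖φ‖ ≤ A * ‖(evolution C - algebraMap ℂ (WalkSpace →L[ℂ] WalkSpace) (g * ζ)) φ‖ +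
        B * ‖restrictTo s φ‖ := by
  set c := |ζ.re| - ‖a‖ with hc
  have hc0 : 0 < c := by linarith
  obtain ⟨s, hs⟩ := hC (c / 2) (by positivity)
  refine ⟨s, 2 / c, 4 * Real.sqrt s.card / c, fun φ => ?_⟩
  have h1 := norm_evolution_sub_evolution_le C (fun _ => D) s (by positivity) hs φ
  have h2 := h.mul_norm_le_norm_evolution_sub hζ φ
  have e : (evolution C - algebraMap ℂ (WalkSpace →L[ℂ] WalkSpace) (g * ζ)) φ =
      evolution C φ - (g * ζ) • φ := by
    simp [Algebra.algebraMap_eq_smul_one]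
  rw [e]
  have h3 := norm_sub_le (evolution C φ - (g * ζ) • φ)
    (evolution C φ - evolution (fun _ => D) φ)
  rw [sub_sub_sub_cancel_left] at h3
  rw [div_mul_eq_mul_div, div_mul_eq_mul_div, ← add_div, le_div_iff₀ hc0]
  linarith

lemma mem_discreteSpectrum (h : IsPhaseMul D.1 g a b) (hC : CoinTendsTo C D) (hζ : ‖ζ‖ = 1)
    (hre : ‖a‖ < |ζ.re|) (hz : g * ζ ∈ pointSpectrum (evolution C)) :
    g * ζ ∈ discreteSpectrum (evolution C) := by
  obtain ⟨s, A, B, hb⟩ := h.norm_le_of_abs_re_gt hC hζ hre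
  refine ⟨hz, ?_, ?_⟩
  · have := finiteDimensional_ker_of_norm_le _ (restrictTo s) hb
    refine Module.End.eigenspace_def (R := ℂ) (M := WalkSpace) ▸ ?_
    exact this
  · obtain ⟨ε, hε, hw⟩ := exists_isUnit_sub_algebraMap _ (isStarNormal_evolution_sub C (g * ζ))
      (restrictTo s) hb
    refine ⟨ε, hε, fun w hws hd => ?_⟩
    by_contra hne
    refine hws ?_
    have := hw (w - g * ζ) (sub_ne_zero.2 hne) (by rwa [← dist_eq_norm])
    rw [map_sub, sub_sub_sub_cancel_right] at this
    rw [spectrum.mem_resolventSet_iff, ← neg_sub]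
    exact this.neg

/-- m solves m² - 2(Re ζ)m + |a|² = 0. Dividing by a gives both the plane-wave factor and an
eigenvalue of the transfer matrix; the other eigenvalue is m̄/a. -/
lemma exists_trace_root (a : ℂ) {ζ : ℂ} (hre : |ζ.re| ≤ ‖a‖) :
    ∃ m : ℂ, m * star m = a * star a ∧ m + star m = ζ + star ζ ∧ (|ζ.re| < ‖a‖ → m ≠ star m) := by
  have hsq : 0 ≤ ‖a‖ ^ 2 - ζ.re ^ 2 := by
    have := pow_le_pow_left₀ (abs_nonneg _) hre 2
    rw [sq_abs] at this
    linarith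
  refine ⟨⟨ζ.re, Real.sqrt (‖a‖ ^ 2 - ζ.re ^ 2)⟩, ?_, ?_, ?_⟩
  · have h1 := Real.mul_self_sqrt hsq
    have h2 : Complex.normSq a = ‖a‖ ^ 2 := Complex.normSq_eq_norm_sq a
    simp only [Complex.star_def, Complex.mul_conj]
    rw [h2, Complex.normSq_mk, h1]
    norm_num [sq]
  · apply Complex.ext <;> simp
  · intro hlt heq
    have h1 := congrArg Complex.im heq
    have h2 : 0 < Real.sqrt (‖a‖ ^ 2 - ζ.re ^ 2) := by
      refine Real.sqrt_pos.2 ?_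
      have := pow_lt_pow_left₀ hlt (abs_nonneg _) two_ne_zero
      rw [sq_abs] at this
      linarith
    simp at h1
    linarith

/-- Plane waves of the position-independent walk. -/
lemma exists_plane_wave (h : IsPhaseMul D.1 g a b) (hζ : ‖ζ‖ = 1) (hre : |ζ.re| ≤ ‖a‖) :
    ∃ (κ : ℂ) (v : EuclideanSpace ℂ (Fin 2)), ‖κ‖ = 1 ∧ v ≠ 0 ∧
      κ * coinAct D v 0 = g * ζ * v 0 ∧ coinAct D v 1 = g * ζ * κ * v 1 := by
  obtain ⟨m, hm1, hm2, -⟩ := exists_trace_root a hre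
  have hr := h.star_mul_row
  have ha : a ≠ 0 := h.ne_zero
  have hn : ζ * star ζ = 1 := by
    simp [Complex.mul_conj, Complex.normSq_eq_norm_sq, hζ]
  obtain ⟨κ, hκ⟩ : ∃ κ : ℂ, κ * a = m := ⟨m / a, div_mul_cancel₀ _ ha⟩
  have hκ1 : κ * star κ = 1 := by
    have : a * star a ≠ 0 := mul_ne_zero ha (star_ne_zero.2 ha)
    refine mul_right_cancel₀ this ?_
    rw [← hκ, star_mul] at hm1
    linear_combination hm1
  have hκn : ‖κ‖ = 1 := by
    have := congrArg norm hκ1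
    rw [norm_mul, norm_star, norm_one] at this
    nlinarith [norm_nonneg κ]
  -- The dispersion relation κa + conj(κa) = 2 Re ζ is exactly solvability of the plane-wave
  -- equations for ψ(x) = κˣv.
  have hdet : (!![κ * a - ζ, κ * b; -star b, star a - ζ * κ] : Matrix (Fin 2) (Fin 2) ℂ).det
      = 0 := by
    rw [Matrix.det_fin_two_of]
    have e : κ * (ζ + star ζ) = κ * (κ * a) + star a := by
      rw [← hm2, ← hκ, star_mul]
      linear_combination star a * hκ1
    linear_combination κ * hr + ζ * e - κ * hn
  obtain ⟨u, hu0, hu⟩ := Matrix.exists_mulVec_eq_zero_iff.2 hdet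
  have e0 := congrFun hu 0
  have e1 := congrFun hu 1
  simp only [Matrix.mulVec, dotProduct, Fin.sum_univ_two, Matrix.of_apply, Matrix.cons_val',
    Matrix.cons_val_zero, Matrix.cons_val_one, Matrix.cons_val_fin_one, Pi.zero_apply] at e0 e1
  refine ⟨κ, WithLp.toLp 2 u, hκn, fun hz => hu0 ?_, ?_, ?_⟩
  · exact congrArg (fun w : EuclideanSpace ℂ (Fin 2) => w.ofLp) hz
  · rw [coinAct_apply, h.entry00, h.entry01]
    linear_combination g * e0
  · rw [coinAct_apply, h.entry10, h.entry11]
    linear_combination g * e1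

end IsPhaseMul

/-- The position state `|x⟩ ⊗ (u, v)`. -/
abbrev siteState (x : ℤ) (v : EuclideanSpace ℂ (Fin 2)) : WalkSpace :=
  lp.single (E := fun _ : ℤ => EuclideanSpace ℂ (Fin 2)) 2 x v

lemma norm_siteState (x : ℤ) (v : EuclideanSpace ℂ (Fin 2)) : ‖siteState x v‖ = ‖v‖ :=
  lp.norm_single (E := fun _ : ℤ => EuclideanSpace ℂ (Fin 2)) (by norm_num) x v

lemma entry11_ne_zero (A : U2) (h : A.1 0 0 ≠ 0) : A.1 1 1 ≠ 0 := by
  intro hd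
  have h1 := congrFun (congrFun (Matrix.mem_unitaryGroup_iff.1 A.2) 1) 1
  have h2 := congrFun (congrFun (Matrix.mem_unitaryGroup_iff'.1 A.2) 0) 0
  simp [Matrix.mul_apply, Fin.sum_univ_two, Matrix.star_apply, hd] at h1 h2
  rw [mul_comm] at h1
  rw [h1] at h2
  simp at h2
  exact h h2

/-- Reading the two components at x - 1 and x + 1 leaves only the coin at x. The equations link the
pair (ψ(x-1)₀, ψ(x)₁) to (ψ(x)₀, ψ(x+1)₁), which is the transfer form. -/
lemma entry_eq_of_eigenvector {C : ℤ → U2} {z : ℂ} {ψ : WalkSpace}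
    (hψ : evolution C ψ = z • ψ) (x : ℤ) :
    (C x).1 0 0 * ψ x 0 + (C x).1 0 1 * ψ x 1 = z * ψ (x - 1) 0 ∧
    (C x).1 1 0 * ψ x 0 + (C x).1 1 1 * ψ x 1 = z * ψ (x + 1) 1 := by
  have h1 := congrArg (fun φ : WalkSpace => φ (x - 1) 0) hψ
  have h2 := congrArg (fun φ : WalkSpace => φ (x + 1) 1) hψ
  simp only [evolution_apply] at h1 h2
  constructor
  · simpa using h1
  · simpa using h2

/-- An eigenvector with vanishing transfer data at one position is zero. -/
lemma eq_zero_of_transfer_eq_zero {C : ℤ → U2} {z : ℂ} (hz : z ≠ 0) {ψ : WalkSpace}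
    (hψ : evolution C ψ = z • ψ) (ha : ∀ x, (C x).1 0 0 ≠ 0) {n : ℤ}
    (h0 : ψ (n - 1) 0 = 0) (h1 : ψ n 1 = 0) : ψ = 0 := by
  have key : ∀ x, ψ (x - 1) 0 = 0 ∧ ψ x 1 = 0 := by
    intro x
    induction x using Int.inductionOn' (b := n) with
    | zero => exact ⟨h0, h1⟩
    | succ k _ ih =>
      obtain ⟨e1, e2⟩ := entry_eq_of_eigenvector hψ k
      rw [ih.1, ih.2, mul_zero, mul_zero, add_zero] at e1
      have h3 : ψ k 0 = 0 := (mul_eq_zero.1 e1).resolve_left (ha k)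
      rw [ih.2, h3, mul_zero, mul_zero, add_zero] at e2
      exact ⟨by rwa [add_sub_cancel_right], (mul_eq_zero.1 e2.symm).resolve_left hz⟩
    | pred k _ ih =>
      obtain ⟨e1, e2⟩ := entry_eq_of_eigenvector hψ (k - 1)
      rw [sub_add_cancel, ih.1, ih.2, mul_zero, mul_zero, zero_add] at e2
      have h3 : ψ (k - 1) 1 = 0 := (mul_eq_zero.1 e2).resolve_left (entry11_ne_zero _ (ha _))
      rw [ih.1, h3, mul_zero, mul_zero, add_zero] at e1
      exact ⟨(mul_eq_zero.1 e1.symm).resolve_left hz, h3⟩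
  ext x i
  fin_cases i
  · simpa using (key (x + 1)).1
  · exact (key x).2

lemma tendsto_coord_atTop (ψ : WalkSpace) (i : Fin 2) :
    Filter.Tendsto (fun n : ℕ => ψ n i) Filter.atTop (nhds 0) := by
  have h1 := ((walk_summable_coord ψ i).comp_injective Nat.cast_injective).tendsto_atTop_zero
  have h2 := (Real.continuous_sqrt.tendsto 0).comp h1
  rw [Real.sqrt_zero] at h2
  rw [tendsto_zero_iff_norm_tendsto_zero]
  refine h2.congr fun n => ?_
  simp [Real.sqrt_sq (norm_nonneg _)]

/-! ### Band interior: approximate eigenvectors, no eigenvalues -/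

namespace IsPhaseMul

variable {D : U2} {g a b ζ : ℂ} {C : ℤ → U2}

/-- Truncated plane waves are approximate eigenvectors. -/
lemma exists_approx_eigenvector (h : IsPhaseMul D.1 g a b) (hζ : ‖ζ‖ = 1) (hre : |ζ.re| ≤ ‖a‖)
    (n : ℤ) (N : ℕ) : ∃ ψ : WalkSpace, ‖ψ‖ = Real.sqrt N ∧ (∀ x < n, ψ x = 0) ∧
      ‖evolution (fun _ => D) ψ - (g * ζ) • ψ‖ ≤ 4 := by
  obtain ⟨κ, v₀, hκ, hv₀, hv₀0, hv₀1⟩ := h.exists_plane_wave hζ hre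
  obtain ⟨v, hv, hv0, hv1⟩ : ∃ v : EuclideanSpace ℂ (Fin 2), ‖v‖ = 1 ∧
      κ * coinAct D v 0 = g * ζ * v 0 ∧ coinAct D v 1 = g * ζ * κ * v 1 := by
    have hs : coinAct D (((‖v₀‖⁻¹ : ℝ) : ℂ) • v₀) = ((‖v₀‖⁻¹ : ℝ) : ℂ) • coinAct D v₀ :=
      map_smul _ _ _
    refine ⟨((‖v₀‖⁻¹ : ℝ) : ℂ) • v₀, ?_, ?_, ?_⟩
    · rw [norm_smul, Complex.norm_real, norm_inv, norm_norm,
        inv_mul_cancel₀ (norm_ne_zero_iff.2 hv₀)]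
    · rw [hs, PiLp.smul_apply, PiLp.smul_apply, smul_eq_mul, smul_eq_mul]
      linear_combination ((‖v₀‖⁻¹ : ℝ) : ℂ) * hv₀0
    · rw [hs, PiLp.smul_apply, PiLp.smul_apply, smul_eq_mul, smul_eq_mul]
      linear_combination ((‖v₀‖⁻¹ : ℝ) : ℂ) * hv₀1
  have hκ0 : κ ≠ 0 := norm_ne_zero_iff.1 (by rw [hκ]; exact one_ne_zero)
  have hκz : ∀ x : ℤ, ‖κ ^ x‖ = 1 := fun x => by rw [norm_zpow, hκ, one_zpow]
  let f : ℤ → WalkSpace := fun x => siteState x !₂[κ ^ x * v 0, 0]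
  let f' : ℤ → WalkSpace := fun x => siteState x !₂[0, κ ^ x * v 1]
  have hf : ∀ x, ‖f x‖ ≤ 1 := fun x => by
    rw [norm_siteState, ← hv, EuclideanSpace.norm_eq, Real.sqrt_le_left (norm_nonneg _),
      EuclideanSpace.norm_sq_eq]
    simp [hκz]
  have hf' : ∀ x, ‖f' x‖ ≤ 1 := fun x => by
    rw [norm_siteState, ← hv, EuclideanSpace.norm_eq, Real.sqrt_le_left (norm_nonneg _),
      EuclideanSpace.norm_sq_eq]
    simp [hκz]
  -- One component of the wave moves left and the other right, so (U - gζ)ψ telescopes in each. The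
  -- offset -1 lets both telescope over the same k, leaving four boundary terms of norm at most 1.
  let F : ℕ → WalkSpace := fun k => f (n + k - 1)
  let F' : ℕ → WalkSpace := fun k => f' (n + k)
  have hsite : ∀ x : ℤ, siteState x (κ ^ x • v) = f x + f' x := fun x => by
    simp only [f, f', siteState]
    rw [← lp.single_add]
    congr 1
    ext i
    fin_cases i <;> simp
  have hU : ∀ x : ℤ, evolution (fun _ => D) (siteState x (κ ^ x • v)) =
      (g * ζ) • (f (x - 1) + f' (x + 1)) := fun x => by
    simp only [siteState]
    rw [evolution_single, smul_add]
    simp only [f, f', siteState]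
    rw [← lp.single_smul, ← lp.single_smul]
    congr 2
    · ext i
      fin_cases i
      · simp only [map_smul]
        simp only [PiLp.smul_apply, smul_eq_mul, Fin.zero_eta, Matrix.cons_val_zero]
        rw [zpow_sub_one₀ hκ0]
        field_simp
        linear_combination hv0
      · simp
    · ext i
      fin_cases i
      · simp
      · simp only [map_smul]
        simp only [PiLp.smul_apply, smul_eq_mul, Fin.mk_one, Matrix.cons_val_one,
          Matrix.cons_val_fin_one]
        rw [zpow_add_one₀ hκ0]
        linear_combination κ ^ x * hv1
  let emb : ℕ ↪ ℤ := ⟨fun k => n + k, fun i j hij => by simpa using hij⟩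
  have hemb : ∀ k, emb k = n + k := fun _ => rfl
  refine ⟨∑ x ∈ (Finset.range N).map emb, siteState x (κ ^ x • v), ?_, ?_, ?_⟩
  · have h2 := lp.norm_sum_single (E := fun _ : ℤ => EuclideanSpace ℂ (Fin 2)) (p := 2)
      (by norm_num) (fun x => κ ^ x • v) ((Finset.range N).map emb)
    simp only [norm_smul, hκz, hv] at h2
    rw [eq_comm, Real.sqrt_eq_iff_eq_sq (by positivity) (norm_nonneg _), eq_comm]
    simpa using h2
  · intro x hx
    rw [lp.coeFn_sum, Finset.sum_apply]
    refine Finset.sum_eq_zero fun y hy => ?_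
    obtain ⟨k, -, rfl⟩ := Finset.mem_map.1 hy
    refine lp.single_apply_ne 2 _ _ ?_
    rw [hemb]
    omega
  · rw [map_sum, Finset.smul_sum, ← Finset.sum_sub_distrib, Finset.sum_map]
    have hterm : ∀ k ∈ Finset.range N, evolution (fun _ => D) (siteState (emb k) (κ ^ emb k • v)) -
        (g * ζ) • siteState (emb k) (κ ^ emb k • v) =
        (g * ζ) • ((F' (k + 1) - F' k) - (F (k + 1) - F k)) := by
      intro k _
      rw [hU, hsite, ← smul_sub]
      simp only [F, F', hemb, Nat.cast_add, Nat.cast_one]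
      rw [← add_assoc, add_sub_cancel_right]
      congr 1
      abel
    rw [Finset.sum_congr rfl hterm, ← Finset.smul_sum, Finset.sum_sub_distrib,
      Finset.sum_range_sub, Finset.sum_range_sub, norm_smul, norm_mul, h.norm_phase, hζ, one_mul,
      one_mul]
    have t1 := norm_sub_le (F' N - F' 0) (F N - F 0)
    have t2 := norm_sub_le (F' N) (F' 0)
    have t3 := norm_sub_le (F N) (F 0)
    have t4 : ‖F' N‖ ≤ 1 := hf' _
    have t5 : ‖F' 0‖ ≤ 1 := hf' _
    have t6 : ‖F N‖ ≤ 1 := hf _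
    have t7 : ‖F 0‖ ≤ 1 := hf _
    linarith

lemma mem_spectrum_of_abs_re_le (h : IsPhaseMul D.1 g a b) (hC : CoinTendsTo C D) (hζ : ‖ζ‖ = 1)
    (hre : |ζ.re| ≤ ‖a‖) : g * ζ ∈ spectrum ℂ (evolution C) := by
  intro hu
  rw [spectrum.mem_resolventSet_iff, ContinuousLinearMap.isUnit_iff_bijective,
    ContinuousLinearMap.bijective_iff_dense_range_and_antilipschitz] at hu
  obtain ⟨-, c, hc⟩ := hu
  have hb : ∀ φ : WalkSpace, ‖φ‖ ≤ c * ‖evolution C φ - (g * ζ) • φ‖ := fun φ => by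
    have := hc.le_mul_dist φ 0
    rw [map_zero, dist_zero_right, dist_zero_right] at this
    rw [norm_sub_rev]
    simpa [Algebra.algebraMap_eq_smul_one] using this
  have hcpos : (0 : ℝ) < c + 1 := by positivity
  -- The coin error then absorbs half of ‖ψ‖, leaving ‖ψ‖ ≤ 8(c + 1); a plane wave of length N
  -- beyond s, with √N > 8(c + 1), contradicts this.
  obtain ⟨s, hs⟩ := hC (1 / (2 * (c + 1))) (by positivity)
  obtain ⟨n, hn⟩ : ∃ n : ℤ, ∀ x ∈ s, x < n := by
    obtain ⟨M, hM⟩ := s.bddAbove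
    exact ⟨M + 1, fun x hx => by have := hM hx; omega⟩
  obtain ⟨N, hN⟩ := exists_nat_gt ((8 * (c + 1) : ℝ) ^ 2)
  obtain ⟨ψ, hψ, hψ0, hψe⟩ := h.exists_approx_eigenvector hζ hre n N
  have hr : restrictTo s ψ = 0 := funext fun x => hψ0 _ (hn _ x.2)
  have h1 := norm_evolution_sub_evolution_le C (fun _ => D) s (by positivity) hs ψ
  rw [hr, norm_zero, mul_zero, add_zero] at h1
  have h2 := hb ψ
  have h3 := norm_add_le (evolution C ψ - evolution (fun _ => D) ψ)
    (evolution (fun _ => D) ψ - (g * ζ) • ψ)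
  rw [sub_add_sub_cancel] at h3
  have h4 : 8 * (c + 1) < Real.sqrt N := Real.lt_sqrt_of_sq_lt hN
  rw [← hψ] at h4
  have h5 : ‖ψ‖ ≤ (c + 1) * (1 / (2 * (c + 1)) * ‖ψ‖ + 4) := by
    refine h2.trans (mul_le_mul (by linarith) (by linarith) (norm_nonneg _) hcpos.le)
  have h6 : (c + 1) * (1 / (2 * (c + 1)) * ‖ψ‖ + 4) = ‖ψ‖ / 2 + 4 * (c + 1) := by
    field_simp
  linarith

/-- Along the right half-line the transfer data of an eigenvector satisfy a summable perturbation of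
an elliptic recurrence and tend to zero by square summability. They vanish somewhere, hence the
eigenvector is zero. -/
lemma notMem_pointSpectrum (h : IsPhaseMul D.1 g a b) (hζ : ‖ζ‖ = 1) (hre : |ζ.re| < ‖a‖)
    (ha : ∀ x, (C x).1 0 0 ≠ 0) {e : ℕ → ℝ} (he : Summable e)
    (hC : ∀ (n : ℕ) i j, ‖(C n).1 i j - D.1 i j‖ ≤ e n) :
    g * ζ ∉ pointSpectrum (evolution C) := by
  intro hz
  obtain ⟨ψ, hψ0, hψ⟩ := exists_eigenvector_of_mem_pointSpectrum hz
  have hg0 : g ≠ 0 := norm_ne_zero_iff.1 (by rw [h.norm_phase]; exact one_ne_zero)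
  have hζ0 : ζ ≠ 0 := norm_ne_zero_iff.1 (by rw [hζ]; exact one_ne_zero)
  have hn : ζ * star ζ = 1 := by
    simp [Complex.mul_conj, Complex.normSq_eq_norm_sq, hζ]
  have ha0 := h.ne_zero
  have hr := h.star_mul_row
  obtain ⟨m, hm1, hm2, hm3⟩ := exists_trace_root a hre.le
  have hmn : ‖m‖ = ‖a‖ := by
    have := congrArg norm hm1
    rw [norm_mul, norm_mul, norm_star, norm_star] at this
    nlinarith [norm_nonneg m, norm_nonneg a, norm_pos_iff.2 ha0]
  have hapos : 0 < ‖a‖ := norm_pos_iff.2 ha0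
  have ha1 : ‖a‖ ≤ 1 := by nlinarith [h.norm_row, sq_nonneg ‖b‖, norm_nonneg a]
  have hb1 : ‖b‖ ≤ 1 := by nlinarith [h.norm_row, sq_nonneg ‖a‖, norm_nonneg b]
  have he0 : ∀ n, 0 ≤ e n := fun n => (norm_nonneg _).trans (hC n 0 0)
  let p₁ := ContinuousLinearMap.fst ℂ ℂ ℂ
  let p₂ := ContinuousLinearMap.snd ℂ ℂ ℂ
  -- The transfer matrix of D at gζ, with trace 2(Re ζ)/a and determinant ā/a; hence its eigenvalues
  -- are m/a and m̄/a.
  let T : ℂ × ℂ →L[ℂ] ℂ × ℂ :=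
    ((ζ / a) • p₁ - (b / a) • p₂).prod ((star ζ / a) • p₂ - (star b / a) • p₁)
  let w : ℕ → ℂ × ℂ := fun n => (ψ (n - 1) 0, ψ n 1)
  obtain ⟨n, hwn⟩ := exists_eq_zero_of_elliptic (w := w) (e := fun n => 4 / ‖a‖ * e n) T
    (a := m / a) (b := star m / a)
    (fun hh => hm3 hre ((div_left_inj' ha0).1 hh))
    (by rw [norm_div, hmn, div_self hapos.ne'])
    (by rw [norm_div, norm_star, hmn, div_self hapos.ne'])
    (by
      rintro ⟨u, v⟩
      have e1 : m / a + star m / a = (ζ + star ζ) / a := by rw [← hm2]; ring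
      have e2 : m / a * (star m / a) = star a / a := by
        rw [div_mul_div_comm, hm1]
        field_simp
      rw [e1, e2]
      ext
      · simp [T, p₁, p₂] at hr hn ⊢
        field_simp
        linear_combination u * hr - u * hn
      · simp [T, p₁, p₂] at hr hn ⊢
        field_simp
        linear_combination v * hr - v * hn)
    (fun n => by have := he0 n; positivity) (he.mul_left _)
    (fun n => by
      obtain ⟨e1, e2⟩ := entry_eq_of_eigenvector hψ n
      -- Residuals of ψ in the transfer equations of D, controlled by C(n) - D. As ψ(n)₀ belongs to
      -- w (n + 1), the error bound must involve both w n and w (n + 1).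
      set r₁ := ζ * ψ (n - 1 : ℤ) 0 - (a * ψ n 0 + b * ψ n 1) with hr₁
      set r₂ := ζ * ψ (n + 1 : ℤ) 1 - (-(star b) * ψ n 0 + star a * ψ n 1) with hr₂
      have hψn0 : ‖ψ n 0‖ ≤ ‖w (n + 1)‖ := by
        simp [w]
      have hψn1 : ‖ψ n 1‖ ≤ ‖w n‖ := norm_snd_le (w n)
      set R := e n * (‖w n‖ + ‖w (n + 1)‖) with hR
      have hbound : ∀ i, ‖((C n).1 i 0 - D.1 i 0) * ψ n 0 + ((C n).1 i 1 - D.1 i 1) * ψ n 1‖ ≤ R :=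
        fun i => by
          refine (norm_add_le _ _).trans ?_
          rw [norm_mul, norm_mul, hR, mul_add, add_comm]
          exact add_le_add (mul_le_mul (hC n i 1) hψn1 (norm_nonneg _) (he0 n))
            (mul_le_mul (hC n i 0) hψn0 (norm_nonneg _) (he0 n))
      have hb₁ : ‖r₁‖ ≤ R := by
        have : g * r₁ =
            ((C n).1 0 0 - D.1 0 0) * ψ n 0 + ((C n).1 0 1 - D.1 0 1) * ψ n 1 := by
          rw [h.entry00, h.entry01, hr₁]
          linear_combination -e1
        have h2 := hbound 0
        rwa [← this, norm_mul, h.norm_phase, one_mul] at h2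
      have hb₂ : ‖r₂‖ ≤ R := by
        have : g * r₂ =
            ((C n).1 1 0 - D.1 1 0) * ψ n 0 + ((C n).1 1 1 - D.1 1 1) * ψ n 1 := by
          rw [h.entry10, h.entry11, hr₂]
          linear_combination -e2
        have h2 := hbound 1
        rwa [← this, norm_mul, h.norm_phase, one_mul] at h2
      have hR0 : 0 ≤ R := (norm_nonneg _).trans hb₁
      have hRa : R ≤ R / ‖a‖ := le_div_self hR0 hapos ha1
      have c1 : (w (n + 1) - T (w n)).1 = -(r₁ / a) := by
        simp only [w, T, p₁, p₂]
        simp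
        rw [hr₁]
        field_simp
        ring
      have c2 : (w (n + 1) - T (w n)).2 = star ζ * (star b * r₁ / a + r₂) := by
        simp only [w, T, p₁, p₂]
        simp [hr₁, hr₂] at hr hn ⊢
        field_simp
        linear_combination
          (-(a * ψ (n + 1 : ℤ) 1) - (starRingEnd ℂ) b * ψ (n - 1 : ℤ) 0) * hn +
            (starRingEnd ℂ) ζ * ψ n 1 * hr
      rw [Prod.norm_def, c1, c2]
      have hfin : 2 * (R / ‖a‖) ≤ 4 / ‖a‖ * e n * (‖w n‖ + ‖w (n + 1)‖) := by
        have : 4 / ‖a‖ * e n * (‖w n‖ + ‖w (n + 1)‖) = 4 * (R / ‖a‖) := by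
          rw [hR]
          ring
        rw [this]
        linarith
      refine le_trans (max_le ?_ ?_) hfin
      · rw [norm_neg, norm_div]
        have := div_le_div_of_nonneg_right hb₁ hapos.le
        linarith
      · rw [norm_mul, norm_star, hζ, one_mul]
        refine (norm_add_le _ _).trans ?_
        rw [norm_div, norm_mul, norm_star]
        have : ‖b‖ * ‖r₁‖ / ‖a‖ ≤ R / ‖a‖ := by
          refine div_le_div_of_nonneg_right ?_ hapos.le
          nlinarith [norm_nonneg r₁]
        linarith)
    (by
      refine Filter.Tendsto.prodMk_nhds ?_ (tendsto_coord_atTop ψ 1)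
      rw [← Filter.tendsto_add_atTop_iff_nat 1]
      simp [tendsto_coord_atTop ψ 0])
  refine hψ0 (eq_zero_of_transfer_eq_zero (mul_ne_zero hg0 hζ0) hψ ha (n := n) ?_ ?_)
  · exact congrArg Prod.fst hwn
  · exact congrArg Prod.snd hwn

end IsPhaseMul

/-! ### The concrete coins, edges and band angles -/

lemma IsPhaseMul.mem_unitaryGroup {A : Matrix (Fin 2) (Fin 2) ℂ} {g a b : ℂ}
    (h : IsPhaseMul A g a b) : A ∈ Matrix.unitaryGroup (Fin 2) ℂ := by
  have hg : g * star g = 1 := by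
    simp [Complex.mul_conj, Complex.normSq_eq_norm_sq, h.norm_phase]
  have hr := h.star_mul_row
  rw [Matrix.mem_unitaryGroup_iff]
  ext i j
  fin_cases i <;> fin_cases j <;>
    simp [Matrix.mul_apply, Fin.sum_univ_two, Matrix.star_apply, h.entry00, h.entry01, h.entry10,
      h.entry11] at hr hg ⊢
  · linear_combination g * (starRingEnd ℂ) g * hr + hg
  · ring
  · ring
  · linear_combination g * (starRingEnd ℂ) g * hr + hg

lemma isPhaseMul_coinZero {p q α β γ : ℝ} (hp : 0 < p) (hq : 0 ≤ q) (hpq : p ^ 2 + q ^ 2 = 1) :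
    IsPhaseMul (coinZero p q α β γ) (Complex.exp (Complex.I * (γ / 2)))
      (p * Complex.exp (Complex.I * (α - γ / 2))) (q * Complex.exp (Complex.I * (β - γ / 2))) := by
  have hn : ∀ x : ℂ, x.im = 0 → ‖Complex.exp (Complex.I * x)‖ = 1 := fun x hx => by
    simp [Complex.norm_exp, hx]
  have hγ : ‖Complex.exp (Complex.I * (γ / 2))‖ = 1 := hn _ (by simp)
  have hα : ‖Complex.exp (Complex.I * (α - γ / 2))‖ = 1 := hn _ (by simp)
  have hβ : ‖Complex.exp (Complex.I * (β - γ / 2))‖ = 1 := hn _ (by simp)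
  refine ⟨hγ, ?_, ?_, ?_, ?_, ?_, ?_⟩
  · rw [norm_mul, norm_mul, hα, hβ, Complex.norm_of_nonneg hp.le, Complex.norm_of_nonneg hq]
    simpa using hpq
  · exact mul_ne_zero (by exact_mod_cast hp.ne') (Complex.exp_ne_zero _)
  all_goals simp [coinZero, ← Complex.exp_conj, map_ofNat]

lemma norm_le_add_coord (v : EuclideanSpace ℂ (Fin 2)) : ‖v‖ ≤ ‖v 0‖ + ‖v 1‖ := by
  rw [EuclideanSpace.norm_eq, Real.sqrt_le_left (by positivity), Fin.sum_univ_two]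
  nlinarith [norm_nonneg (v 0), norm_nonneg (v 1)]

lemma norm_coinAct_sub_le {A B : U2} {m : ℝ} (h : ∀ i j, ‖A.1 i j - B.1 i j‖ ≤ m)
    (v : EuclideanSpace ℂ (Fin 2)) : ‖coinAct A v - coinAct B v‖ ≤ 4 * m * ‖v‖ := by
  have hm : 0 ≤ m := (norm_nonneg _).trans (h 0 0)
  have hc : ∀ i, ‖(coinAct A v - coinAct B v) i‖ ≤ 2 * m * ‖v‖ := fun i => by
    rw [PiLp.sub_apply, coinAct_apply, coinAct_apply,
      show A.1 i 0 * v 0 + A.1 i 1 * v 1 - (B.1 i 0 * v 0 + B.1 i 1 * v 1) =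
        (A.1 i 0 - B.1 i 0) * v 0 + (A.1 i 1 - B.1 i 1) * v 1 by ring]
    refine (norm_add_le _ _).trans ?_
    rw [norm_mul, norm_mul]
    have h0 := mul_le_mul (h i 0) (PiLp.norm_apply_le v 0) (norm_nonneg _) hm
    have h1 := mul_le_mul (h i 1) (PiLp.norm_apply_le v 1) (norm_nonneg _) hm
    linarith
  have := norm_le_add_coord (coinAct A v - coinAct B v)
  linarith [hc 0, hc 1]

lemma ExpClose.exists_entry_le {C : ℤ → U2} {D : U2} (h : ExpClose C D.1) :
    ∃ ρ M : ℝ, 0 < ρ ∧ 0 < M ∧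
      ∀ (x : ℤ) i j, ‖(C x).1 i j - D.1 i j‖ ≤ M * Real.exp (-ρ * |(x : ℝ)|) := by
  obtain ⟨ρ, M, hρ, hM, hx⟩ := h
  refine ⟨ρ, M, hρ, hM, fun x i j => ?_⟩
  have h1 : ‖(C x).1 i j - D.1 i j‖ ≤ maxEntryNorm ((C x).1 - D.1) := by
    unfold maxEntryNorm
    fin_cases i <;> fin_cases j <;> simp
  refine h1.trans ((hx x).trans ?_)
  gcongr M * Real.exp ?_
  have : |(x : ℝ)| ≤ Real.sqrt (1 + (x : ℝ) ^ 2) := Real.abs_le_sqrt (by linarith)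
  nlinarith

lemma summable_exp_neg_mul_nat {ρ : ℝ} (hρ : 0 < ρ) (M : ℝ) :
    Summable fun n : ℕ => M * Real.exp (-ρ * |((n : ℤ) : ℝ)|) := by
  refine Summable.mul_left M ?_
  have := Real.summable_exp_nat_mul_iff.2 (neg_lt_zero.2 hρ)
  refine this.congr fun n => ?_
  simp [mul_comm]

lemma edgeUnion_subset (Y : Finset ℤ) :
    edgeUnion Y ⊆ ↑(Y.biUnion fun y => ({y - 1, y} : Finset ℤ)) := by
  intro x hx
  simpa [edgeUnion, edge] using hx

lemma ExpClose.coinTendsTo {C : ℤ → U2} {D C₁ : U2} (h : ExpClose C D.1) (Y : Finset ℤ) :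
    CoinTendsTo (defectCoin (edgeUnion Y) C₁ C) D := by
  intro ε hε
  obtain ⟨ρ, M, hρ, hM, hx⟩ := h.exists_entry_le
  -- The 4 compensates the factor lost in `norm_coinAct_sub_le`.
  obtain ⟨R, hR⟩ := ((summable_exp_neg_mul_nat hρ M).tendsto_atTop_zero.eventually
    (gt_mem_nhds (show 0 < ε / 4 by positivity))).exists
  refine ⟨Y.biUnion (fun y => ({y - 1, y} : Finset ℤ)) ∪ Finset.Icc (-R : ℤ) R, fun x hxs v => ?_⟩
  rw [Finset.mem_union, not_or] at hxs
  have hxe : x ∉ edgeUnion Y := fun hh => hxs.1 (edgeUnion_subset Y hh)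
  have hxR : (R : ℝ) ≤ |(x : ℝ)| := by
    have h2 := hxs.2
    rw [Finset.mem_Icc, ← abs_le, not_le] at h2
    exact_mod_cast h2.le
  rw [defectCoin, if_neg hxe]
  refine (norm_coinAct_sub_le (hx x) v).trans (mul_le_mul_of_nonneg_right ?_ (norm_nonneg _))
  have : M * Real.exp (-ρ * |(x : ℝ)|) ≤ M * Real.exp (-ρ * |((R : ℤ) : ℝ)|) := by
    gcongr M * Real.exp ?_
    simp only [Int.cast_natCast, Nat.abs_cast]
    nlinarith
  linarith

/-- The two eigenvalues of a state trapped on an edge defect. -/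
lemma mem_pointSpectrum_of_edge {C : ℤ → U2} {y : ℤ} {β' γ' : ℝ}
    (h0 : C (y - 1) = coinOne β' γ') (h1 : C y = coinOne β' γ') {z : ℂ}
    (hz : z ^ 2 = -Complex.exp (Complex.I * γ')) : z ∈ pointSpectrum (evolution C) := by
  have e01 : (coinOneMatrix β' γ') 0 1 = Complex.exp (Complex.I * β') := by
    simp only [coinOneMatrix, Matrix.smul_apply, Matrix.of_apply, Matrix.cons_val', smul_eq_mul,
      Matrix.cons_val_zero, Matrix.cons_val_one, Matrix.cons_val_fin_one, ← Complex.exp_add]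
    ring_nf
  have e10 : (coinOneMatrix β' γ') 1 0 * Complex.exp (Complex.I * β') =
      -Complex.exp (Complex.I * γ') := by
    simp only [coinOneMatrix, Matrix.smul_apply, Matrix.of_apply, Matrix.cons_val', smul_eq_mul,
      Matrix.cons_val_zero, Matrix.cons_val_one, Matrix.cons_val_fin_one, mul_neg, neg_mul,
      ← Complex.exp_add]
    ring_nf
  have e00 : (coinOneMatrix β' γ') 0 0 = 0 := by simp [coinOneMatrix]
  have e11 : (coinOneMatrix β' γ') 1 1 = 0 := by simp [coinOneMatrix]
  have hz0 : z ≠ 0 := by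
    rintro rfl
    simp at hz
  -- U swaps the lower state at y with the upper state at y - 1 up to phases, and its square there
  -- is -e^{iγ'}. The weights z and e^{iβ'} make the combination an eigenvector.
  refine mem_pointSpectrum_of_eigenvector (ψ := siteState y !₂[0, z] +
    siteState (y - 1) !₂[Complex.exp (Complex.I * β'), 0]) (fun hh => ?_) ?_
  · have := congrArg (fun φ : WalkSpace => φ y 1) hh
    simp [siteState] at this
    exact hz0 this
  · simp only [siteState]
    rw [map_add, evolution_single, evolution_single, h0, h1]
    simp only [coinAct_apply, coinOne, e00, e01, e11]
    simp only [Matrix.cons_val_zero, Matrix.cons_val_one, Matrix.cons_val_fin_one, mul_zero,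
      zero_mul, add_zero, e10, zero_add]
    have hzero : (!₂[0, 0] : EuclideanSpace ℂ (Fin 2)) = 0 := by
      ext i
      fin_cases i <;> rfl
    rw [hzero, lp.single_zero, lp.single_zero, sub_add_cancel, add_zero, zero_add, smul_add,
      ← lp.single_smul, ← lp.single_smul, ← hz, add_comm]
    congr 2
    · ext i
      fin_cases i <;> simp [sq]
    · ext i
      fin_cases i <;> simp [mul_comm]

lemma abs_cos_eq_of_mem_thresholdAngles {p γ θ : ℝ} (hp : p ∈ Set.Ioc (0 : ℝ) 1)
    (hθ : θ ∈ thresholdAngles p γ) : |Real.cos (θ - γ / 2)| = p := by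
  have hc : Real.cos (Real.arccos p) = p := Real.cos_arccos (by linarith [hp.1]) hp.2
  have ha : |p| = p := abs_of_pos hp.1
  rcases hθ with rfl | rfl | rfl | rfl <;> rw [add_sub_cancel_right]
  · rw [hc, ha]
  · rw [Real.cos_pi_sub, hc, abs_neg, ha]
  · rw [add_comm, Real.cos_add_pi, hc, abs_neg, ha]
  · rw [Real.cos_two_pi_sub, hc, ha]

lemma abs_cos_lt_of_mem_bandAngles {p γ θ : ℝ} (hp : p ∈ Set.Ioc (0 : ℝ) 1)
    (hθ : θ ∈ bandAngles p γ \ thresholdAngles p γ) : |Real.cos (θ - γ / 2)| < p := by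
  have hc : Real.cos (Real.arccos p) = p := Real.cos_arccos (by linarith [hp.1]) hp.2
  have key : ∀ t, Real.arccos p < t → t < Real.pi - Real.arccos p → |Real.cos t| < p := by
    intro t h1 h2
    have h0 := Real.arccos_nonneg p
    have h3 := Real.cos_lt_cos_of_nonneg_of_le_pi h0 (by linarith) h1
    have h4 := Real.cos_lt_cos_of_nonneg_of_le_pi (h0.trans h1.le) (by linarith) h2
    rw [Real.cos_pi_sub] at h4
    rw [hc] at h3 h4
    exact abs_lt.2 ⟨h4, h3⟩
  obtain ⟨hb, ht⟩ := hθ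
  simp only [thresholdAngles, Set.mem_insert_iff, Set.mem_singleton_iff, not_or] at ht
  obtain ⟨t1, t2, t3, t4⟩ := ht
  rcases hb with ⟨h1, h2⟩ | ⟨h1, h2⟩
  · have h1' := lt_of_le_of_ne h1 (Ne.symm t1)
    have h2' := lt_of_le_of_ne h2 t2
    exact key _ (by linarith) (by linarith)
  · have h1' := lt_of_le_of_ne h1 (Ne.symm t3)
    have h2' := lt_of_le_of_ne h2 t4
    have := key (θ - γ / 2 - Real.pi) (by linarith) (by linarith)
    rwa [Real.cos_sub_pi, abs_neg] at this

lemma exists_thresholdAngle_of_abs_re_eq {p γ : ℝ} {ζ : ℂ} (hζ : ‖ζ‖ = 1) (hre : |ζ.re| = p) :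
    ∃ θ ∈ thresholdAngles p γ,
      Complex.exp (Complex.I * (γ / 2)) * ζ = Complex.exp (Complex.I * θ) := by
  have hexp : ζ = Complex.exp (Complex.I * ζ.arg) := by
    have := Complex.norm_mul_exp_arg_mul_I ζ
    rw [hζ, Complex.ofReal_one, one_mul] at this
    rw [mul_comm, this]
  have hcos : ζ.re = Real.cos ζ.arg := by
    rw [Complex.cos_arg (norm_ne_zero_iff.1 (by rw [hζ]; exact one_ne_zero)), hζ, div_one]
  have hle := Complex.arg_le_pi ζ
  have hlt := Complex.neg_pi_lt_arg ζ
  have key : ∀ θ : ℝ, (θ = ζ.arg + γ / 2 ∨ θ = ζ.arg + 2 * Real.pi + γ / 2) →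
      Complex.exp (Complex.I * (γ / 2)) * ζ = Complex.exp (Complex.I * θ) := by
    intro θ hθ
    nth_rw 1 [hexp]
    rw [← Complex.exp_add]
    rcases hθ with rfl | rfl
    · congr 1
      push_cast
      ring
    · rw [Complex.exp_eq_exp_iff_exists_int]
      refine ⟨-1, ?_⟩
      push_cast
      ring
  have hpm : ζ.re = p ∨ ζ.re = -p := by
    rcases abs_choice ζ.re with h | h
    · exact Or.inl (by rw [← hre, h])
    · exact Or.inr (by rw [← hre, h, neg_neg])
  -- `Complex.arg` takes values in (-π, π]; a negative argument is moved by 2π to reach the second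
  -- interval.
  rcases le_or_gt 0 ζ.arg with h0 | h0
  · have harg : ζ.arg = Real.arccos ζ.re := by rw [hcos, Real.arccos_cos h0 hle]
    rcases hpm with h | h
    · rw [h] at harg
      exact ⟨_, Or.inl rfl, key _ (Or.inl (by rw [harg]))⟩
    · rw [h, Real.arccos_neg] at harg
      exact ⟨_, Or.inr (Or.inl rfl), key _ (Or.inl (by rw [harg]))⟩
  · have harg : -ζ.arg = Real.arccos ζ.re := by
      rw [hcos, ← Real.cos_neg, Real.arccos_cos (by linarith) (by linarith)]
    rcases hpm with h | h
    · rw [h] at harg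
      exact ⟨_, Or.inr (Or.inr (Or.inr rfl)), key _ (Or.inr (by rw [← harg]; ring))⟩
    · rw [h, Real.arccos_neg] at harg
      exact ⟨_, Or.inr (Or.inr (Or.inl rfl)), key _ (Or.inr (by linarith))⟩

namespace IsPhaseMul

variable {D : U2} {g a b : ℂ} {C : ℤ → U2}

/-- Points in the interior of the bands belong to the essential spectrum. -/
lemma mem_essSpectrum (h : IsPhaseMul D.1 g a b) (hC : CoinTendsTo C D) {t : ℝ}
    (ht : |Real.cos t| < ‖a‖) :
    g * Complex.exp (Complex.I * t) ∈ essSpectrum (evolution C) := by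
  have hnorm : ∀ s : ℝ, ‖Complex.exp (Complex.I * s)‖ = 1 := fun s => by
    simp [Complex.norm_exp]
  have hre : ∀ s : ℝ, (Complex.exp (Complex.I * s)).re = Real.cos s := fun s => by
    rw [mul_comm, Complex.exp_ofReal_mul_I_re]
  refine ⟨h.mem_spectrum_of_abs_re_le hC (hnorm t) (by rw [hre]; exact ht.le), ?_⟩
  rintro ⟨-, -, ε, hε, hiso⟩
  have c1 : ∀ᶠ s in nhds t, |Real.cos s| < ‖a‖ :=
    (continuous_abs.comp Real.continuous_cos).continuousAt.eventually (gt_mem_nhds ht)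
  have c2 : ∀ᶠ s : ℝ in nhds t, dist (g * Complex.exp (Complex.I * s))
      (g * Complex.exp (Complex.I * t)) < ε := by
    have : Continuous fun s : ℝ => g * Complex.exp (Complex.I * s) := by fun_prop
    exact this.continuousAt.eventually (Metric.ball_mem_nhds _ hε)
  obtain ⟨δ, hδ, hs⟩ := Metric.eventually_nhds_iff.1 (c1.and c2)
  -- A displacement below δ stays in the band and within ε; being at most 1 < π, it has sin r > 0,
  -- so the new spectral point is different.
  set r := min (δ / 2) 1 with hr
  have hr0 : 0 < r := lt_min (by positivity) one_pos
  have hr1 : r ≤ 1 := min_le_right _ _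
  obtain ⟨hs1, hs2⟩ := hs (y := t + r) (by
    rw [Real.dist_eq, add_sub_cancel_left, abs_of_pos hr0]
    linarith [min_le_left (δ / 2) 1])
  have heq := hiso _ (h.mem_spectrum_of_abs_re_le hC (hnorm _) (by rw [hre]; exact hs1.le)) hs2
  have hg0 : g ≠ 0 := norm_ne_zero_iff.1 (by rw [h.norm_phase]; exact one_ne_zero)
  have h2 := mul_left_cancel₀ hg0 heq
  rw [Complex.ofReal_add, mul_add, Complex.exp_add, mul_eq_left₀ (Complex.exp_ne_zero _)] at h2
  have h3 := congrArg Complex.im h2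
  rw [mul_comm, Complex.exp_ofReal_mul_I_im, Complex.one_im] at h3
  linarith [Real.sin_pos_of_pos_of_lt_pi hr0 (by linarith [Real.pi_gt_three])]

end IsPhaseMul

end

theorem corollary1p4 (p q α β γ β' γ' : ℝ)
    (hp : p ∈ Set.Ioc (0 : ℝ) 1) (hq : q ∈ Set.Icc (0 : ℝ) 1) (hpq : p ^ 2 + q ^ 2 = 1)
    (hα : α ∈ Set.Ico 0 (2 * Real.pi)) (hβ : β ∈ Set.Ico 0 (2 * Real.pi))
    (hγ : γ ∈ Set.Ico 0 (2 * Real.pi)) (hβ' : β' ∈ Set.Ico 0 (2 * Real.pi))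
    (hγ' : γ' ∈ Set.Ico 0 (2 * Real.pi))
    (hJ : ∃ k : ℤ, (γ' + Real.pi) / 2 + 2 * Real.pi * k ∈ bandAngles p γ \ thresholdAngles p γ)
    (Y : Finset ℤ) (C₂ : ℤ → U2)
    (hC₂ : ExpClose C₂ (coinZero p q α β γ))
    (hδ : ∃ δ : ℝ, 0 < δ ∧ ∀ x : ℤ, δ ≤ ‖(C₂ x).1 0 0‖)
    (C : ℤ → U2) (hC : C = defectCoin (edgeUnion Y) (coinOne β' γ') C₂) :
    ((∀ y : ℤ, ¬ IsEdgeDefect C y) ↔ edgeUnion Y = ∅) ∧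
    (edgeUnion Y = ∅ ↔
      ∀ z ∈ essSpectrum (evolution C) \ thresholds p γ (evolution C),
        z ∉ pointSpectrum (evolution C)) := by
  obtain ⟨δ, hδ0, hδ⟩ := hδ
  have ha2 : ∀ x, (C₂ x).1 0 0 ≠ 0 := fun x => norm_pos_iff.1 (hδ0.trans_le (hδ x))
  have hP := isPhaseMul_coinZero (α := α) (β := β) (γ := γ) hp.1 hq.1 hpq
  let D : U2 := ⟨coinZero p q α β γ, hP.mem_unitaryGroup⟩
  replace hP : IsPhaseMul D.1 _ _ _ := hP
  replace hC₂ : ExpClose C₂ D.1 := hC₂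
  set g := Complex.exp (Complex.I * (γ / 2)) with hg
  set a := p * Complex.exp (Complex.I * (α - γ / 2)) with ha
  have hnorm : ‖a‖ = p := by
    rw [ha, norm_mul, Complex.norm_of_nonneg hp.1.le]
    simp [Complex.norm_exp]
  have hgn : g * star g = 1 := by
    simp [Complex.mul_conj, Complex.normSq_eq_norm_sq, hP.norm_phase]
  have hT : CoinTendsTo C D := hC ▸ hC₂.coinTendsTo Y
  have hedge : ∀ y ∈ Y, ∀ x ∈ edge y, C x = coinOne β' γ' := by
    intro y hy x hx
    rw [hC, defectCoin, if_pos (show x ∈ edgeUnion Y from Set.mem_iUnion₂.2 ⟨y, hy, hx⟩)]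
  have hempty : edgeUnion Y = ∅ → C = C₂ := by
    intro h
    rw [hC, h]
    funext x
    simp [defectCoin]
  have hne : ¬ edgeUnion Y = ∅ → ∃ y, y ∈ Y := by
    intro h
    obtain ⟨x, hx⟩ := Set.nonempty_iff_ne_empty.2 h
    obtain ⟨y, hy, -⟩ := Set.mem_iUnion₂.1 hx
    exact ⟨y, hy⟩
  refine ⟨⟨fun h => ?_, fun h y => ?_⟩, ⟨fun h => ?_, fun h => ?_⟩⟩
  · by_contra hcon
    obtain ⟨y, hy⟩ := hne hcon
    exact h y ⟨β', hβ', γ', hγ', fun x hx => congrArg Subtype.val (hedge y hy x hx)⟩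
  · rintro ⟨b₁, -, c₁, -, hx⟩
    have := hx y (Or.inr rfl)
    rw [hempty h] at this
    refine ha2 y ?_
    rw [this]
    simp [coinOneMatrix]
  · have hCC := hempty h
    rintro z ⟨hess, hthr⟩ hz
    have hz1 := norm_eq_one_of_mem_pointSpectrum hz
    obtain ⟨ζ, rfl⟩ : ∃ ζ, z = g * ζ := ⟨star g * z, by rw [← mul_assoc, hgn, one_mul]⟩
    have hζ : ‖ζ‖ = 1 := by rwa [norm_mul, hP.norm_phase, one_mul] at hz1
    -- Band interior, threshold, gap.
    rcases lt_trichotomy |ζ.re| p with hlt | heq | hgt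
    · obtain ⟨ρ, M, hρ, -, hM⟩ := hC₂.exists_entry_le
      refine hP.notMem_pointSpectrum (C := C) hζ (by rwa [hnorm]) (by rwa [hCC])
        (summable_exp_neg_mul_nat hρ M) (fun n => ?_) hz
      rw [hCC]
      exact hM n
    · exact hthr ⟨hess, exists_thresholdAngle_of_abs_re_eq hζ heq⟩
    · exact hess.2 (hP.mem_discreteSpectrum hT hζ (by rwa [hnorm]) hz)
  · by_contra hcon
    obtain ⟨y, hy⟩ := hne hcon
    obtain ⟨k, hk⟩ := hJ
    -- The multiple 2πk is dropped, since only cos t and e^{it} matter; g e^{it} = e^{i(γ'+π)/2}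
    -- squares to -e^{iγ'}.
    set t := (γ' + Real.pi) / 2 - γ / 2 with ht
    have hcos : |Real.cos t| < p := by
      have := abs_cos_lt_of_mem_bandAngles hp hk
      rwa [show (γ' + Real.pi) / 2 + 2 * Real.pi * k - γ / 2 = t + k * (2 * Real.pi) by
        rw [ht]; ring, Real.cos_add_int_mul_two_pi] at this
    have hpt : g * Complex.exp (Complex.I * t) ∈ pointSpectrum (evolution C) := by
      refine mem_pointSpectrum_of_edge (hedge y hy _ (Or.inl rfl)) (hedge y hy _ (Or.inr rfl)) ?_
      rw [hg, ← Complex.exp_add, ← Complex.exp_nat_mul, ht]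
      push_cast
      rw [show 2 * (Complex.I * (γ / 2) + Complex.I * ((γ' + Real.pi) / 2 - γ / 2)) =
        Complex.I * γ' + Real.pi * Complex.I by ring, Complex.exp_add_pi_mul_I]
    refine h _ ⟨hP.mem_essSpectrum hT (by rwa [hnorm]), ?_⟩ hpt
    rintro ⟨-, θ, hθ, heq⟩
    have hexp : Complex.exp (Complex.I * t) = Complex.exp (Complex.I * (θ - γ / 2 : ℝ)) := by
      have hg0 : g ≠ 0 := Complex.exp_ne_zero _
      refine mul_left_cancel₀ hg0 (heq.trans ?_)
      rw [hg, ← Complex.exp_add]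
      congr 1
      push_cast
      ring
    have hre := congrArg Complex.re hexp
    rw [mul_comm, Complex.exp_ofReal_mul_I_re, mul_comm, Complex.exp_ofReal_mul_I_re] at hre
    rw [hre, abs_cos_eq_of_mem_thresholdAngles hp hθ] at hcos
    exact lt_irrefl _ hcos
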